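/- Let $n\ge 1$. Write $B(x,r)$ for the open ball in $\mathbf{R}^n$ with center $x$ and radius $r>0$, and $|B(x,r)|$ for its Lebesgue measure. Let $U\subset\mathbf{R}^n$ be open, and let $w\ge 0$ be a locally integrable function in $U$. (Averages of nonnegative functions take values in $[0,\infty]$.) We say that $w$ is *doubling* in $U$ with constant $A>0$ if $$\frac{1}{|B(x,2r)|}\int_{B(x,2r)} w\,dx\le A\,\frac{1}{|B(x,r)|}\int_{B(x,r)} w\,dx\quad\text{for all balls } B(x,4r)\subset U;$$ that $w$ satisfies the *weak reverse Hölder inequality* in $U$ with exponent $q>1$ and constant $B>0$ if $$\Bigl(\frac{1}{|B(x,r)|}\int_{B(x,r)} w^q\,dx\Bigr)^{1/q}\le B\,\frac{1}{|B(x,2r)|}\int_{B(x,2r)} w\,dx\quad\text{for all balls } B(x,2r)\subset U;$$ and that $\log w\in BMO(U)$ with constant $D>0$ if $w>0$ almost everywhere in $U$ and, for all balls $B(x,2r)\subset U$, $\log w$ is integrable on $B(x,r)$ and $$\frac{1}{|B(x,r)|}\int_{B(x,r)}\Bigl|\log w(y)-\frac{1}{|B(x,r)|}\int_{B(x,r)}\log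 w(z)\,dz\Bigr|^2dy\le D.$$ **(a)** Suppose that $w$ satisfies a weak reverse Hölder inequality in $U$ (for some $q>1$ and $B>0$), and that $w$ does not vanish almost everywhere on any connected component of $U$. Then $w$ is doubling in $U$ (for some constant) if and only if $\log w\in BMO(U)$ (for some constant). **(b)** For all $q>1$, $B>0$ and $D>0$ there is a constant $C=C(n,q,B,D)>0$ such that, for every open $U\subset\mathbf{R}^n$ and every locally integrable $w\ge0$ in $U$ that satisfies the weak reverse Hölder inequality in $U$ with exponent $q$ and constant $B$, and for which $\log w\in BMO(U)$ with constant $D$, $$\frac{1}{|B(x,2r)|}\int_{B(x,2r)} w\,dx\le C\,\frac{1}{|B(x,r)|}\int_{B(x,r)} w\,dx\quad\text{for all balls } B(x,4r)\subset U.$$ -/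

import Mathlib

open MeasureTheory

/-- `w` is doubling in `U` with constant `A`:
`⨍_{B(x,2r)} w ≤ A ⨍_{B(x,r)} w` for all balls with `B(x,4r) ⊆ U`.
Averages of the nonnegative function `w` are taken in `[0,∞]`. -/
def IsDoublingWith {n : ℕ} (w : EuclideanSpace ℝ (Fin n) → ℝ)
    (U : Set (EuclideanSpace ℝ (Fin n))) (A : ℝ) : Prop :=
  ∀ (x : EuclideanSpace ℝ (Fin n)) (r : ℝ), 0 < r → Metric.ball x (4 * r) ⊆ U →
    (⨍⁻ y in Metric.ball x (2 * r), ENNReal.ofReal (w y) ∂volume) ≤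
      ENNReal.ofReal A * ⨍⁻ y in Metric.ball x r, ENNReal.ofReal (w y) ∂volume

/-- `w` is doubling in `U`. -/
def IsDoubling {n : ℕ} (w : EuclideanSpace ℝ (Fin n) → ℝ)
    (U : Set (EuclideanSpace ℝ (Fin n))) : Prop :=
  ∃ A : ℝ, 0 < A ∧ IsDoublingWith w U A

/-- `w` satisfies the weak reverse Hölder inequality in `U` with exponent `q` and constant `B`:
`(⨍_{B(x,r)} w^q)^{1/q} ≤ B ⨍_{B(x,2r)} w` for all balls with `B(x,2r) ⊆ U`.
Averages are taken in `[0,∞]`. -/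
def WeakReverseHolderWith {n : ℕ} (w : EuclideanSpace ℝ (Fin n) → ℝ)
    (U : Set (EuclideanSpace ℝ (Fin n))) (q B : ℝ) : Prop :=
  ∀ (x : EuclideanSpace ℝ (Fin n)) (r : ℝ), 0 < r → Metric.ball x (2 * r) ⊆ U →
    (⨍⁻ y in Metric.ball x r, ENNReal.ofReal (w y) ^ q ∂volume) ^ (1 / q) ≤
      ENNReal.ofReal B * ⨍⁻ y in Metric.ball x (2 * r), ENNReal.ofReal (w y) ∂volume

/-- `w` satisfies a weak reverse Hölder inequality in `U`, for some exponent `q > 1`. -/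
def WeakReverseHolder {n : ℕ} (w : EuclideanSpace ℝ (Fin n) → ℝ)
    (U : Set (EuclideanSpace ℝ (Fin n))) : Prop :=
  ∃ q B : ℝ, 1 < q ∧ 0 < B ∧ WeakReverseHolderWith w U q B

/-- `u ∈ BMO(U)` with constant `D`: for all balls with `B(x,2r) ⊆ U`, `u` is integrable on
`B(x,r)` (so that its mean is meaningful) and `⨍_{B(x,r)} |u - ⨍_{B(x,r)} u|² ≤ D`.
The outer average is taken in `[0,∞]`, so that the bound includes square integrability. -/
def IsBMOWith {n : ℕ} (u : EuclideanSpace ℝ (Fin n) → ℝ)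
    (U : Set (EuclideanSpace ℝ (Fin n))) (D : ℝ) : Prop :=
  ∀ (x : EuclideanSpace ℝ (Fin n)) (r : ℝ), 0 < r → Metric.ball x (2 * r) ⊆ U →
    IntegrableOn u (Metric.ball x r) volume ∧
    (⨍⁻ y in Metric.ball x r,
      ENNReal.ofReal (|u y - ⨍ z in Metric.ball x r, u z ∂volume| ^ 2) ∂volume) ≤
      ENNReal.ofReal D

/-- `log w ∈ BMO(U)` with constant `D`. The function `log w` has to be defined (finite) almost
everywhere in `U`, that is, `w > 0` almost everywhere in `U`; this is stated separately because
`Real.log 0 = 0`. -/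
def LogIsBMOWith {n : ℕ} (w : EuclideanSpace ℝ (Fin n) → ℝ)
    (U : Set (EuclideanSpace ℝ (Fin n))) (D : ℝ) : Prop :=
  (∀ᵐ x ∂(volume.restrict U), 0 < w x) ∧ IsBMOWith (fun x => Real.log (w x)) U D

/-- `log w ∈ BMO(U)`. -/
def LogIsBMO {n : ℕ} (w : EuclideanSpace ℝ (Fin n) → ℝ)
    (U : Set (EuclideanSpace ℝ (Fin n))) : Prop :=
  ∃ D : ℝ, 0 < D ∧ LogIsBMOWith w U D

/-! Both directions compare averages of `w` with level sets of `w`, on balls small enough to stay in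
`U`.

From BMO to doubling: on a ball B(y,s), Chebyshev makes the set where `log w` exceeds its mean by
`l` small, and Hölder with the weak reverse Hölder inequality bounds the integral of `w` there by ε
times the average over B(y,2s). So the average over B(y,s) is at most exp(mean + l) plus that error.
Integrated over y, this bounds the integral over one ball by that over a slightly larger ball, plus
a main term. As the scale is halved, the radii increase from 2r to below 7r/2 and the means of `log
w` drift by at most κ = √(D·4ⁿ) per step, so the main term grows like e^{κj}. With ε = e^{-κ}/2 the
iteration sums to a geometric series (`setLIntegral_step_le`, `le_two_mul_of_recurrence`). Jensen
bounds exp of the mean of `log w` over B(x,r) by the average of `w` there.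

From doubling to BMO: doubling turns the weak inequality into a reverse Hölder inequality on a
single ball, so `w` is at least half its mean on a fixed fraction c of each ball. A stopping-time
argument with a Vitali covering shows that the sublevel sets {w < τβᵏ} lose a fixed proportion of
their measure at each level, up to a slight shrinking of the ball (`volume_sublevel_inter_ball_le`,
`volume_sublevel_le_pow`). This decay makes (log w − log τ)² integrable where w < τ; where w ≥ τ it
is at most 4w/τ. Nonvanishing on components enters through `setLIntegral_ne_zero`, which makes the
reference average τ positive. -/

namespace WeakReverseHolderDoubling

open Set Filter Metric
open scoped ENNReal NNReal Topology

/-! ### Hölder, Chebyshev and Jensen estimates on a probability space. -/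

section Probability

variable {Ω : Type*} [MeasurableSpace Ω]

lemma setLIntegral_le_rpow_mul_measure_rpow {μ : Measure Ω} {f : Ω → ℝ≥0∞} (hf : AEMeasurable f μ)
    {q : ℝ} (hq : 1 < q) {F : Set Ω} (hF : MeasurableSet F) :
    ∫⁻ x in F, f x ∂μ ≤ (∫⁻ x, f x ^ q ∂μ) ^ (1 / q) * μ F ^ (1 - 1 / q) := by
  have hpq : q.HolderConjugate (Real.conjExponent q) := Real.HolderConjugate.conjExponent hq
  have h := ENNReal.lintegral_mul_le_Lp_mul_Lq μ hpq hf
    (g := F.indicator fun _ => 1) (measurable_const.indicator hF).aemeasurable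
  have hexp : 1 / Real.conjExponent q = 1 - 1 / q := by
    have := hpq.inv_add_inv_eq_one
    simp only [one_div]; linarith
  have hg : ∀ a, (F.indicator (fun _ => (1 : ℝ≥0∞)) a) ^ Real.conjExponent q
      = F.indicator (fun _ => 1) a := by
    intro a
    by_cases ha : a ∈ F <;> simp [ha, hpq.symm.pos]
  have hl : ∀ a, (f * (F.indicator fun _ => (1 : ℝ≥0∞))) a = F.indicator f a := by
    intro a
    by_cases ha : a ∈ F <;> simp [ha]
  simp only [hg, hl, lintegral_indicator hF, hexp] at h
  simpa using h

/-- A reverse Hölder inequality forces a function to be comparable to its mean on a set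
of substantial measure. -/
lemma half_le_mul_measure_rpow {P : Measure Ω} [IsProbabilityMeasure P] {f : Ω → ℝ≥0∞}
    (hf : Measurable f) {q : ℝ} (hq : 1 < q) {K : ℝ≥0∞} (h0 : ∫⁻ x, f x ∂P ≠ 0)
    (hT : ∫⁻ x, f x ∂P ≠ ∞)
    (h : (∫⁻ x, f x ^ q ∂P) ^ (1 / q) ≤ K * ∫⁻ x, f x ∂P) :
    2⁻¹ ≤ K * P {x | (∫⁻ x, f x ∂P) / 2 ≤ f x} ^ (1 - 1 / q) := by
  set τ := ∫⁻ x, f x ∂P with hτ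
  set F := {x | τ / 2 ≤ f x} with hFdef
  have hF : MeasurableSet F := measurableSet_le measurable_const hf
  -- The points below half the mean carry at most half of the integral, so `F` carries the rest;
  -- Hölder on `F` then bounds its measure from below.
  have h1 : ∫⁻ x in Fᶜ, f x ∂P ≤ τ / 2 := by
    calc ∫⁻ x in Fᶜ, f x ∂P ≤ ∫⁻ x in Fᶜ, τ / 2 ∂P :=
          setLIntegral_mono measurable_const fun x hx => (not_le.1 (show ¬ τ / 2 ≤ f x from hx)).le
      _ ≤ τ / 2 := by
          rw [setLIntegral_const]
          exact mul_le_of_le_one_right' prob_le_one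
  have h2 := setLIntegral_le_rpow_mul_measure_rpow (μ := P) hf.aemeasurable hq hF
  have h3 : τ ≤ K * τ * P F ^ (1 - 1 / q) + τ / 2 := by
    calc τ = ∫⁻ x in F, f x ∂P + ∫⁻ x in Fᶜ, f x ∂P := (lintegral_add_compl f hF).symm
      _ ≤ _ := add_le_add (h2.trans (mul_le_mul_left h _)) h1
  have h4 : τ / 2 ≤ K * τ * P F ^ (1 - 1 / q) := by
    have : τ / 2 + τ / 2 ≤ K * τ * P F ^ (1 - 1 / q) + τ / 2 := by rwa [ENNReal.add_halves]
    exact (ENNReal.add_le_add_iff_right (ENNReal.div_ne_top hT (by simp))).1 this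
  have h5 : τ * 2⁻¹ ≤ τ * (K * P F ^ (1 - 1 / q)) := by
    calc τ * 2⁻¹ = τ / 2 := by rw [div_eq_mul_inv]
      _ ≤ _ := h4
      _ = _ := by ring
  exact (ENNReal.mul_le_mul_iff_right h0 hT).1 h5

lemma ofReal_rpow_le_measure {P : Measure Ω} [IsProbabilityMeasure P] {f : Ω → ℝ≥0∞}
    (hf : Measurable f) {q K : ℝ} (hq : 1 < q) (hK : 0 < K) (h0 : ∫⁻ x, f x ∂P ≠ 0)
    (hT : ∫⁻ x, f x ∂P ≠ ∞)
    (h : (∫⁻ x, f x ^ q ∂P) ^ (1 / q) ≤ ENNReal.ofReal K * ∫⁻ x, f x ∂P) :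
    ENNReal.ofReal ((2 * K)⁻¹ ^ (1 - 1 / q)⁻¹) ≤ P {x | (∫⁻ x, f x ∂P) / 2 ≤ f x} := by
  have h1 := half_le_mul_measure_rpow hf hq h0 hT h
  have hp : 0 < 1 - 1 / q := by
    rw [sub_pos, div_lt_one (by linarith)]; exact hq
  have h2 : ENNReal.ofReal (2 * K)⁻¹ ≤
      P {x | (∫⁻ x, f x ∂P) / 2 ≤ f x} ^ (1 - 1 / q) := by
    have h3 : ENNReal.ofReal (2 * K)⁻¹ = (ENNReal.ofReal K)⁻¹ * 2⁻¹ := by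
      rw [mul_inv, mul_comm, ENNReal.ofReal_mul (by positivity), ENNReal.ofReal_inv_of_pos hK,
        ENNReal.ofReal_inv_of_pos two_pos]
      simp
    have hK0 : ENNReal.ofReal K ≠ 0 := by simpa using hK
    rw [h3]
    calc _ ≤ (ENNReal.ofReal K)⁻¹ * (ENNReal.ofReal K * _) := mul_le_mul_right h1 _
      _ = _ := by rw [← mul_assoc, ENNReal.inv_mul_cancel hK0 ENNReal.ofReal_ne_top, one_mul]
  rw [← ENNReal.ofReal_rpow_of_pos (by positivity), ENNReal.rpow_inv_le_iff hp]
  exact h2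

/-- Split at the level exp(m + l): above it, Chebyshev bounds the measure by D/l² and Hölder bounds
the integral. For large `l` the last term becomes a small error. -/
lemma lintegral_le_exp_add_rpow {P : Measure Ω} [IsProbabilityMeasure P] {w : Ω → ℝ}
    (hw : Measurable w) {q m D l : ℝ} (hq : 1 < q) (hl : 0 < l)
    (h : ∫⁻ x, ENNReal.ofReal (|Real.log (w x) - m| ^ 2) ∂P ≤ ENNReal.ofReal D) :
    ∫⁻ x, ENNReal.ofReal (w x) ∂P ≤ ENNReal.ofReal (Real.exp (m + l)) +
      ENNReal.ofReal (D / l ^ 2) ^ (1 - 1 / q) *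
        (∫⁻ x, ENNReal.ofReal (w x) ^ q ∂P) ^ (1 / q) := by
  set F := {x | Real.exp (m + l) < w x} with hFdef
  have hF : MeasurableSet F := measurableSet_lt measurable_const hw
  have hp : 0 < 1 - 1 / q := by
    rw [sub_pos, div_lt_one (by linarith)]; exact hq
  have h1 : ∫⁻ x in Fᶜ, ENNReal.ofReal (w x) ∂P ≤ ENNReal.ofReal (Real.exp (m + l)) := by
    calc ∫⁻ x in Fᶜ, ENNReal.ofReal (w x) ∂P
        ≤ ∫⁻ x in Fᶜ, ENNReal.ofReal (Real.exp (m + l)) ∂P :=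
          setLIntegral_mono measurable_const fun x hx => ENNReal.ofReal_le_ofReal (not_lt.1 hx)
      _ ≤ _ := by
          rw [setLIntegral_const]
          exact mul_le_of_le_one_right' prob_le_one
  have hmeas : Measurable fun x => ENNReal.ofReal (|Real.log (w x) - m| ^ 2) := by
    fun_prop
  have hPF : P F ≤ ENNReal.ofReal (D / l ^ 2) := by
    have hsub : F ⊆ {x | ENNReal.ofReal (l ^ 2) ≤ ENNReal.ofReal (|Real.log (w x) - m| ^ 2)} := by
      intro x hx
      have hx' : m + l < Real.log (w x) :=
        (Real.lt_log_iff_exp_lt ((Real.exp_pos _).trans hx)).2 hx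
      refine ENNReal.ofReal_le_ofReal (pow_le_pow_left₀ hl.le ?_ 2)
      exact (by linarith : l ≤ Real.log (w x) - m).trans (le_abs_self _)
    calc P F ≤ _ := measure_mono hsub
      _ ≤ _ := meas_ge_le_lintegral_div hmeas.aemeasurable (by simpa using hl.ne') (by simp)
      _ ≤ ENNReal.ofReal D / ENNReal.ofReal (l ^ 2) := ENNReal.div_le_div_right h _
      _ = _ := (ENNReal.ofReal_div_of_pos (by positivity)).symm
  have hfm : Measurable fun x => ENNReal.ofReal (w x) := by fun_prop
  have h2 := setLIntegral_le_rpow_mul_measure_rpow (μ := P) hfm.aemeasurable hq hF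
  calc _ = ∫⁻ x in Fᶜ, ENNReal.ofReal (w x) ∂P + ∫⁻ x in F, ENNReal.ofReal (w x) ∂P := by
        rw [add_comm]; exact (lintegral_add_compl _ hF).symm
    _ ≤ _ := by
      refine add_le_add h1 (h2.trans ?_)
      rw [mul_comm]
      gcongr

lemma ofReal_sq_abs_integral_le {P : Measure Ω} [IsProbabilityMeasure P] {g : Ω → ℝ}
    (hg : AEStronglyMeasurable g P) :
    ENNReal.ofReal (|∫ x, g x ∂P| ^ 2) ≤ ∫⁻ x, ENNReal.ofReal (|g x| ^ 2) ∂P := by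
  have h1 : ‖∫ x, g x ∂P‖ₑ ≤ ∫⁻ x, ‖g x‖ₑ ∂P := enorm_integral_le_lintegral_enorm g
  have h2 := setLIntegral_le_rpow_mul_measure_rpow (μ := P) hg.enorm (q := 2) (by norm_num)
    MeasurableSet.univ
  simp only [Measure.restrict_univ, measure_univ, ENNReal.one_rpow, mul_one] at h2
  have h3 := (ENNReal.le_rpow_inv_iff (z := 2) (by norm_num)).1
    ((h1.trans h2).trans_eq (by rw [one_div]))
  have key : ∀ t : ℝ, ENNReal.ofReal (|t| ^ 2) = ‖t‖ₑ ^ (2 : ℝ) := by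
    intro t
    rw [ENNReal.ofReal_pow (abs_nonneg t), ← Real.enorm_eq_ofReal_abs]
    norm_cast
  simpa only [key] using h3

lemma ofReal_exp_integral_log_le {P : Measure Ω} [IsProbabilityMeasure P] {w : Ω → ℝ}
    (hw : Measurable w) (hpos : ∀ᵐ x ∂P, 0 < w x) (hi : Integrable (fun x => Real.log (w x)) P) :
    ENNReal.ofReal (Real.exp (∫ x, Real.log (w x) ∂P)) ≤ ∫⁻ x, ENNReal.ofReal (w x) ∂P := by
  by_cases hT : ∫⁻ x, ENNReal.ofReal (w x) ∂P = ∞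
  · simp [hT]
  have hwi : Integrable w P := by
    refine ⟨hw.aestronglyMeasurable, ?_⟩
    rw [hasFiniteIntegral_iff_ofReal (hpos.mono fun x hx => hx.le)]
    exact lt_top_iff_ne_top.2 hT
  have hexp : (fun x => Real.exp (Real.log (w x))) =ᵐ[P] w :=
    hpos.mono fun x hx => Real.exp_log hx
  have := convexOn_exp.map_integral_le (μ := P) Real.continuous_exp.continuousOn isClosed_univ
    (by simp) hi (hwi.congr hexp.symm)
  rw [← ofReal_integral_eq_lintegral_ofReal hwi (hpos.mono fun x hx => hx.le)]
  exact ENNReal.ofReal_le_ofReal (this.trans_eq (integral_congr_ae hexp))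

/-- Oscillation may be tested against any constant `c`: |u − M|² ≤ 2|u − c|² + 2|M − c|², and Jensen
bounds the last square by the mean of |u − c|². -/
lemma sq_sub_integral_le {P : Measure Ω} [IsProbabilityMeasure P] {u : Ω → ℝ}
    (hu : AEStronglyMeasurable u P) {c C : ℝ}
    (h : ∫⁻ x, ENNReal.ofReal (|u x - c| ^ 2) ∂P ≤ ENNReal.ofReal C) :
    Integrable u P ∧
      ∫⁻ x, ENNReal.ofReal (|u x - ∫ y, u y ∂P| ^ 2) ∂P ≤ ENNReal.ofReal (4 * C) := by
  have hm : AEStronglyMeasurable (fun x => u x - c) P := hu.sub aestronglyMeasurable_const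
  have hsub : Integrable (fun x => u x - c) P := by
    have h2 : Integrable (fun x => (u x - c) ^ 2) P := by
      refine ⟨hm.pow 2, ?_⟩
      rw [hasFiniteIntegral_iff_ofReal (Eventually.of_forall fun x => sq_nonneg _)]
      simp only [sq_abs] at h
      exact h.trans_lt ENNReal.ofReal_lt_top
    exact ((memLp_two_iff_integrable_sq hm).2 h2).integrable (by norm_num)
  have hi : Integrable u P :=
    (hsub.add (integrable_const c)).congr (Eventually.of_forall fun x => by simp)
  refine ⟨hi, ?_⟩
  have h1 := ofReal_sq_abs_integral_le hm
  have h3 : ∫ x, (u x - c) ∂P = ∫ x, u x ∂P - c := by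
    rw [integral_sub hi (integrable_const c)]; simp
  rw [h3] at h1
  set M := ∫ y, u y ∂P
  have h4 : ∀ x, ENNReal.ofReal (|u x - M| ^ 2) ≤
      2 * ENNReal.ofReal (|u x - c| ^ 2) + 2 * ENNReal.ofReal (|M - c| ^ 2) := by
    intro x
    have : |u x - M| ^ 2 ≤ 2 * |u x - c| ^ 2 + 2 * |M - c| ^ 2 := by
      simp only [sq_abs]
      nlinarith [sq_nonneg ((u x - c) + (M - c))]
    calc _ ≤ _ := ENNReal.ofReal_le_ofReal this
      _ = _ := by
        rw [ENNReal.ofReal_add (by positivity) (by positivity),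
          ENNReal.ofReal_mul two_pos.le, ENNReal.ofReal_mul two_pos.le]
        simp
  calc _ ≤ ∫⁻ x, (2 * ENNReal.ofReal (|u x - c| ^ 2) + 2 * ENNReal.ofReal (|M - c| ^ 2)) ∂P :=
        lintegral_mono h4
    _ = 2 * ∫⁻ x, ENNReal.ofReal (|u x - c| ^ 2) ∂P + 2 * ENNReal.ofReal (|M - c| ^ 2) := by
        rw [lintegral_add_right _ measurable_const, lintegral_const_mul' _ _ (by simp)]
        simp
    _ ≤ 2 * ENNReal.ofReal C + 2 * ENNReal.ofReal C := by
        exact add_le_add (mul_le_mul_right h _) (mul_le_mul_right (h1.trans h) _)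
    _ = _ := by
        rw [ENNReal.ofReal_mul (by norm_num), ← two_mul, ← mul_assoc]
        norm_num

end Probability

/-! ### Averages over balls: change of ball, Fubini, chains of centers. -/

section Balls

variable {n : ℕ}

/-- The normalized Lebesgue measure of a ball. -/
noncomputable def ballMeasure (x : EuclideanSpace ℝ (Fin n)) (r : ℝ) :
    Measure (EuclideanSpace ℝ (Fin n)) :=
  (volume (ball x r))⁻¹ • volume.restrict (ball x r)

lemma volume_ball_ne_zero (x : EuclideanSpace ℝ (Fin n)) {r : ℝ} (hr : 0 < r) :
    volume (ball x r) ≠ 0 := (measure_ball_pos volume x hr).ne'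

lemma volume_ball_ne_top (x : EuclideanSpace ℝ (Fin n)) (r : ℝ) :
    volume (ball x r) ≠ ∞ := measure_ball_lt_top.ne

lemma isProbabilityMeasure_ballMeasure (x : EuclideanSpace ℝ (Fin n)) {r : ℝ} (hr : 0 < r) :
    IsProbabilityMeasure (ballMeasure x r) :=
  ⟨by simp [ballMeasure, ENNReal.inv_mul_cancel (volume_ball_ne_zero x hr)
    (volume_ball_ne_top x r)]⟩

lemma setLAverage_ball_eq (f : EuclideanSpace ℝ (Fin n) → ℝ≥0∞) (x : EuclideanSpace ℝ (Fin n))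
    (r : ℝ) : ⨍⁻ y in ball x r, f y ∂volume = ∫⁻ y, f y ∂(ballMeasure x r) := setLAverage_eq' ..

lemma setAverage_ball_eq (f : EuclideanSpace ℝ (Fin n) → ℝ) (x : EuclideanSpace ℝ (Fin n))
    (r : ℝ) : ⨍ y in ball x r, f y ∂volume = ∫ y, f y ∂(ballMeasure x r) := setAverage_eq' ..

lemma setLIntegral_ball_eq (f : EuclideanSpace ℝ (Fin n) → ℝ≥0∞) (x : EuclideanSpace ℝ (Fin n))
    {r : ℝ} (hr : 0 < r) :
    ∫⁻ y in ball x r, f y = volume (ball x r) * ∫⁻ y, f y ∂(ballMeasure x r) := by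
  rw [← setLAverage_ball_eq, setLAverage_eq, ENNReal.mul_div_cancel (volume_ball_ne_zero x hr) (volume_ball_ne_top x r)]

lemma ballMeasure_absolutelyContinuous (x : EuclideanSpace ℝ (Fin n)) {r : ℝ} :
    ballMeasure x r ≪ volume.restrict (ball x r) :=
  Measure.smul_absolutelyContinuous

lemma integrable_ballMeasure {u : EuclideanSpace ℝ (Fin n) → ℝ} {x : EuclideanSpace ℝ (Fin n)}
    {r : ℝ} (hr : 0 < r) :
    Integrable u (ballMeasure x r) ↔ IntegrableOn u (ball x r) :=
  integrable_smul_measure (by simpa using volume_ball_ne_top x r)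
    (by simpa using volume_ball_ne_zero x hr)

lemma ballMeasure_apply (x : EuclideanSpace ℝ (Fin n)) (r : ℝ)
    {s : Set (EuclideanSpace ℝ (Fin n))} (hs : MeasurableSet s) :
    volume (s ∩ ball x r) / volume (ball x r) = ballMeasure x r s := by
  simp [ballMeasure, Measure.restrict_apply hs, div_eq_mul_inv, mul_comm]

lemma volume_ball_mul (x y : EuclideanSpace ℝ (Fin n)) {c : ℝ} (hc : 0 < c) (r : ℝ) :
    volume (ball x (c * r)) = ENNReal.ofReal (c ^ n) * volume (ball y r) := by
  rw [Measure.addHaar_ball_mul_of_pos volume x hc, Measure.addHaar_ball_center volume y]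
  simp

lemma volume_ball_center_eq (x y : EuclideanSpace ℝ (Fin n)) (r : ℝ) :
    volume (ball x r) = volume (ball y r) := by
  rw [Measure.addHaar_ball_center volume x, Measure.addHaar_ball_center volume y]

lemma lintegral_ballMeasure_le_of_subset {x y : EuclideanSpace ℝ (Fin n)} {r s c : ℝ}
    (hc : 0 < c) (hr : r = c * s) (h : ball y s ⊆ ball x r)
    (f : EuclideanSpace ℝ (Fin n) → ℝ≥0∞) :
    ∫⁻ z, f z ∂(ballMeasure y s) ≤ ENNReal.ofReal (c ^ n) * ∫⁻ z, f z ∂(ballMeasure x r) := by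
  have hv : (volume (ball y s))⁻¹ = ENNReal.ofReal (c ^ n) * (volume (ball x r))⁻¹ := by
    have hc0 : ENNReal.ofReal (c ^ n) ≠ 0 := by simpa using pow_pos hc n
    rw [hr, volume_ball_mul x y hc, ENNReal.mul_inv (Or.inl hc0) (Or.inl ENNReal.ofReal_ne_top),
      ← mul_assoc, ENNReal.mul_inv_cancel hc0 ENNReal.ofReal_ne_top, one_mul]
  simp only [ballMeasure, lintegral_smul_measure, smul_eq_mul]
  rw [hv, mul_assoc]
  gcongr

lemma measurableSet_dist_lt (s : ℝ) :
    MeasurableSet {p : EuclideanSpace ℝ (Fin n) × EuclideanSpace ℝ (Fin n) | dist p.2 p.1 < s} :=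
  measurableSet_lt (by fun_prop) measurable_const

lemma lintegral_setLIntegral_ball {f : EuclideanSpace ℝ (Fin n) → ℝ≥0∞} (hf : Measurable f)
    (S : Set (EuclideanSpace ℝ (Fin n))) (s : ℝ) :
    ∫⁻ y in S, ∫⁻ z in ball y s, f z = ∫⁻ z, f z * volume (ball z s ∩ S) := by
  have h1 : ∀ y, ∫⁻ z in ball y s, f z =
      ∫⁻ z, {p : EuclideanSpace ℝ (Fin n) × EuclideanSpace ℝ (Fin n) |
        dist p.2 p.1 < s}.indicator (fun p => f p.2) (y, z) := by
    intro y
    rw [← lintegral_indicator measurableSet_ball]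
    rfl
  simp only [h1]
  rw [lintegral_lintegral_swap (f := fun y z => {p : EuclideanSpace ℝ (Fin n) ×
    EuclideanSpace ℝ (Fin n) | dist p.2 p.1 < s}.indicator (fun p => f p.2) (y, z)) (((hf.comp measurable_snd).indicator
    (measurableSet_dist_lt s)).aemeasurable)]
  refine lintegral_congr fun z => ?_
  have h2 : ∀ y, {p : EuclideanSpace ℝ (Fin n) × EuclideanSpace ℝ (Fin n) |
      dist p.2 p.1 < s}.indicator (fun p => f p.2) (y, z) =
      (ball z s).indicator (fun _ => f z) y := by
    intro y
    simp only [indicator, mem_ofPred_eq, mem_ball, dist_comm z y]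
  simp only [h2]
  rw [lintegral_indicator measurableSet_ball, setLIntegral_const,
    Measure.restrict_apply measurableSet_ball]

/-- By Fubini, a point z of B(x,ρ) is counted with weight |B(z,s) ∩ B(x,σ)| / |B(x,s)|, which is 1
because B(z,s) ⊆ B(x,σ). -/
lemma setLIntegral_le_lintegral_average {f : EuclideanSpace ℝ (Fin n) → ℝ≥0∞} (hf : Measurable f)
    (x : EuclideanSpace ℝ (Fin n)) {ρ σ s : ℝ} (hs : 0 < s) (hσ : ρ + s ≤ σ) :
    ∫⁻ z in ball x ρ, f z ≤ ∫⁻ y in ball x σ, ∫⁻ z, f z ∂(ballMeasure y s) := by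
  have h1 : ∀ y, ∫⁻ z, f z ∂(ballMeasure y s) = (volume (ball x s))⁻¹ * ∫⁻ z in ball y s, f z := by
    intro y
    rw [volume_ball_center_eq x y, ballMeasure, lintegral_smul_measure, smul_eq_mul]
  simp only [h1]
  rw [lintegral_const_mul' _ _ (ENNReal.inv_ne_top.2 (volume_ball_ne_zero x hs)),
    lintegral_setLIntegral_ball hf, ← lintegral_const_mul' _ _
      (ENNReal.inv_ne_top.2 (volume_ball_ne_zero x hs)), ← lintegral_indicator measurableSet_ball]
  refine lintegral_mono fun z => ?_
  by_cases hz : z ∈ ball x ρ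
  · have hsub : ball z s ⊆ ball x σ :=
      ball_subset_ball' (by have := mem_ball.1 hz; linarith)
    rw [indicator_of_mem hz, inter_eq_left.2 hsub, volume_ball_center_eq z x, mul_left_comm,
      ENNReal.inv_mul_cancel (volume_ball_ne_zero x hs) (volume_ball_ne_top x s), mul_one]
  · simp [hz]

/-- The same weight, now with B(x,ρ), is at most 1 everywhere and vanishes outside B(x,σ). -/
lemma lintegral_average_le_setLIntegral {f : EuclideanSpace ℝ (Fin n) → ℝ≥0∞} (hf : Measurable f)
    (x : EuclideanSpace ℝ (Fin n)) {ρ σ s : ℝ} (hs : 0 < s) (hσ : ρ + s ≤ σ) :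
    ∫⁻ y in ball x ρ, ∫⁻ z, f z ∂(ballMeasure y s) ≤ ∫⁻ z in ball x σ, f z := by
  have h1 : ∀ y, ∫⁻ z, f z ∂(ballMeasure y s) = (volume (ball x s))⁻¹ * ∫⁻ z in ball y s, f z := by
    intro y
    rw [volume_ball_center_eq x y, ballMeasure, lintegral_smul_measure, smul_eq_mul]
  simp only [h1]
  rw [lintegral_const_mul' _ _ (ENNReal.inv_ne_top.2 (volume_ball_ne_zero x hs)),
    lintegral_setLIntegral_ball hf, ← lintegral_const_mul' _ _
      (ENNReal.inv_ne_top.2 (volume_ball_ne_zero x hs)), ← lintegral_indicator measurableSet_ball]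
  refine lintegral_mono fun z => ?_
  by_cases hz : z ∈ ball x σ
  · rw [indicator_of_mem hz]
    calc (volume (ball x s))⁻¹ * (f z * volume (ball z s ∩ ball x ρ))
        ≤ (volume (ball x s))⁻¹ * (f z * volume (ball x s)) := by
          rw [volume_ball_center_eq x z]
          gcongr
          exact inter_subset_left
      _ = f z := by
          rw [mul_left_comm,
            ENNReal.inv_mul_cancel (volume_ball_ne_zero x hs) (volume_ball_ne_top x s), mul_one]
  · have : ball z s ∩ ball x ρ = ∅ := by
      refine (ball_disjoint_ball ?_).inter_eq
      have := not_lt.1 (fun h => hz (mem_ball.2 h)); linarith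
    simp [this]

/-- The first link of a chain along the segment, which stays in the ball by convexity. -/
lemma exists_mem_ball_dist_le {x y₁ y₂ : EuclideanSpace ℝ (Fin n)} {R δ : ℝ} (N : ℕ)
    (h₁ : y₁ ∈ ball x R) (h₂ : y₂ ∈ ball x R) (h : dist y₁ y₂ ≤ (N + 1) * δ) :
    ∃ y ∈ ball x R, dist y₁ y ≤ δ ∧ dist y y₂ ≤ N * δ := by
  have hN : (0 : ℝ) < N + 1 := by positivity
  refine ⟨AffineMap.lineMap y₁ y₂ (1 / ((N : ℝ) + 1)), ?_, ?_, ?_⟩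
  · refine (convex_ball x R).lineMap_mem h₁ h₂ ⟨by positivity, ?_⟩
    rw [div_le_one hN]; linarith [(Nat.cast_nonneg N : (0 : ℝ) ≤ N)]
  · rw [dist_left_lineMap, Real.norm_of_nonneg (by positivity), one_div_mul_eq_div, div_le_iff₀ hN]
    linarith
  · rw [dist_lineMap_right]
    have : 1 - 1 / ((N : ℝ) + 1) = N / (N + 1) := by field_simp; ring
    rw [this, Real.norm_of_nonneg (by positivity), div_mul_eq_mul_div, div_le_iff₀ hN]
    nlinarith [(Nat.cast_nonneg N : (0 : ℝ) ≤ N)]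

lemma abs_sub_le_of_chain {x : EuclideanSpace ℝ (Fin n)} {R δ K : ℝ}
    {φ : EuclideanSpace ℝ (Fin n) → ℝ}
    (hφ : ∀ y₁ ∈ ball x R, ∀ y₂ ∈ ball x R, dist y₁ y₂ ≤ δ → |φ y₁ - φ y₂| ≤ K) (N : ℕ) :
    ∀ y₁ ∈ ball x R, ∀ y₂ ∈ ball x R, dist y₁ y₂ ≤ N * δ → |φ y₁ - φ y₂| ≤ N * K := by
  induction N with
  | zero =>
    intro y₁ _ y₂ _ h
    have : y₁ = y₂ := dist_le_zero.1 (by simpa using h)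
    simp [this]
  | succ N ih =>
    intro y₁ h₁ y₂ h₂ h
    push_cast at h ⊢
    obtain ⟨y, hy, hy1, hy2⟩ := exists_mem_ball_dist_le N h₁ h₂ h
    have e1 := hφ y₁ h₁ y hy hy1
    have e2 := ih y hy y₂ h₂ hy2
    have := abs_sub_le (φ y₁) (φ y) (φ y₂)
    linarith

lemma le_pow_mul_of_chain {x : EuclideanSpace ℝ (Fin n)} {R δ : ℝ} {K : ℝ≥0∞}
    {φ : EuclideanSpace ℝ (Fin n) → ℝ≥0∞}
    (hφ : ∀ y₁ ∈ ball x R, ∀ y₂ ∈ ball x R, dist y₁ y₂ ≤ δ → φ y₁ ≤ K * φ y₂) (N : ℕ) :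
    ∀ y₁ ∈ ball x R, ∀ y₂ ∈ ball x R, dist y₁ y₂ ≤ N * δ → φ y₁ ≤ K ^ N * φ y₂ := by
  induction N with
  | zero =>
    intro y₁ _ y₂ _ h
    have : y₁ = y₂ := dist_le_zero.1 (by simpa using h)
    simp [this]
  | succ N ih =>
    intro y₁ h₁ y₂ h₂ h
    push_cast at h
    obtain ⟨y, hy, hy1, hy2⟩ := exists_mem_ball_dist_le N h₁ h₂ h
    calc φ y₁ ≤ K * φ y := hφ y₁ h₁ y hy hy1
      _ ≤ K * (K ^ N * φ y₂) := mul_le_mul_right (ih y hy y₂ h₂ hy2) _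
      _ = _ := by ring

end Balls

/-! ### Drift of the means of a BMO function between balls. -/

section MeanOscillation

variable {n : ℕ} {U : Set (EuclideanSpace ℝ (Fin n))} {u : EuclideanSpace ℝ (Fin n) → ℝ} {D : ℝ}

lemma lintegral_sq_sub_le_of_isBMOWith (h : IsBMOWith u U D) {x : EuclideanSpace ℝ (Fin n)} {r : ℝ}
    (hr : 0 < r) (hU : ball x (2 * r) ⊆ U) :
    ∫⁻ y, ENNReal.ofReal (|u y - ∫ z, u z ∂(ballMeasure x r)| ^ 2) ∂(ballMeasure x r) ≤
      ENNReal.ofReal D := by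
  have := (h x r hr hU).2
  rwa [setLAverage_ball_eq, setAverage_ball_eq] at this

/-- Jensen on the smaller ball, then enlargement to the larger one at the cost of the volume ratio
cⁿ ≤ 4ⁿ. -/
lemma abs_mean_sub_mean_le (hu : Measurable u) (hD : 0 ≤ D) (h : IsBMOWith u U D)
    {x y : EuclideanSpace ℝ (Fin n)} {r s c : ℝ} (hs : 0 < s) (hc : 0 < c) (hc4 : c ≤ 4)
    (hr : r = c * s) (hsub : ball y s ⊆ ball x r) (hU : ball x (2 * r) ⊆ U) :
    |∫ z, u z ∂(ballMeasure y s) - ∫ z, u z ∂(ballMeasure x r)| ≤ √(D * 4 ^ n) := by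
  have hr0 : 0 < r := by rw [hr]; positivity
  have := isProbabilityMeasure_ballMeasure y hs
  have hi : Integrable u (ballMeasure y s) :=
    (integrable_ballMeasure hs).2 ((h x r hr0 hU).1.mono_set hsub)
  set m := ∫ z, u z ∂(ballMeasure x r) with hm
  have h1 := ofReal_sq_abs_integral_le (P := ballMeasure y s) (g := fun z => u z - m)
    (hu.sub measurable_const).aestronglyMeasurable
  rw [integral_sub hi (integrable_const m)] at h1
  simp only [integral_const, probReal_univ, one_smul] at h1
  have h2 := lintegral_ballMeasure_le_of_subset hc hr hsub
    (fun z => ENNReal.ofReal (|u z - m| ^ 2))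
  have h3 := h1.trans (h2.trans (mul_le_mul_right (lintegral_sq_sub_le_of_isBMOWith h hr0 hU) _))
  rw [← ENNReal.ofReal_mul (by positivity), ENNReal.ofReal_le_ofReal_iff (by positivity)] at h3
  refine Real.le_sqrt_of_sq_le (h3.trans ?_)
  rw [mul_comm]
  gcongr

lemma abs_mean_sub_mean_le_of_mem_ball (hu : Measurable u) (hD : 0 ≤ D) (h : IsBMOWith u U D)
    {x y : EuclideanSpace ℝ (Fin n)} {r : ℝ} (hr : 0 < r) (hU : ball x (4 * r) ⊆ U)
    (hy : y ∈ ball x (7 / 2 * r)) (j : ℕ) :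
    |∫ z, u z ∂(ballMeasure y (r / 4 / 2 ^ j)) - ∫ z, u z ∂(ballMeasure x r)| ≤
      (57 + j) * √(D * 4 ^ n) := by
  have hsubU : ∀ z ∈ ball x (7 / 2 * r), ∀ t ≤ r / 4, ball z (2 * t) ⊆ U := fun z hz t ht =>
    (ball_subset_ball' (by have := mem_ball.1 hz; linarith)).trans hU
  set κ := √(D * 4 ^ n)
  induction j with
  | zero =>
    -- Balls of radius r/4 with centers at most r/8 apart both contain B(y₂, r/8), so a link costs
    -- 2κ. Since 28 · r/8 = 7r/2, the chain costs 56κ; passing from B(x, r/4) to B(x, r) adds one κ,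
    -- hence 57.
    have hchain := abs_sub_le_of_chain (x := x) (R := 7 / 2 * r) (δ := r / 8) (K := 2 * κ)
      (φ := fun z => ∫ t, u t ∂(ballMeasure z (r / 4))) (by
        intro y₁ h₁ y₂ h₂ hd
        have e1 := abs_mean_sub_mean_le hu hD h (x := y₁) (y := y₂) (r := r / 4) (s := r / 8)
          (c := 2) (by positivity) two_pos (by norm_num) (by ring)
          (ball_subset_ball' (by rw [dist_comm]; linarith)) (hsubU y₁ h₁ _ le_rfl)
        have e2 := abs_mean_sub_mean_le hu hD h (x := y₂) (y := y₂) (r := r / 4) (s := r / 8)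
          (c := 2) (by positivity) two_pos (by norm_num) (by ring)
          (ball_subset_ball (by linarith)) (hsubU y₂ h₂ _ le_rfl)
        rw [abs_le] at e1 e2 ⊢
        constructor <;> linarith [e1.1, e1.2, e2.1, e2.2]) 28
    have e1 := hchain y hy x (mem_ball_self (by positivity)) (by
      have := mem_ball.1 hy; push_cast; linarith)
    have e2 := abs_mean_sub_mean_le hu hD h (x := x) (y := x) (r := r) (s := r / 4)
          (c := 4) (by positivity) (by norm_num) (by norm_num) (by ring)
          (ball_subset_ball (by linarith)) ((ball_subset_ball (by linarith)).trans hU)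
    simp only [pow_zero, div_one]
    push_cast at e1 ⊢
    rw [abs_le] at e1 e2 ⊢
    constructor <;> linarith [e1.1, e1.2, e2.1, e2.2]
  | succ j ih =>
    have hp : r / 4 / 2 ^ j ≤ r / 4 := div_le_self (by positivity) (one_le_pow₀ (by norm_num))
    have e1 := abs_mean_sub_mean_le hu hD h (x := y) (y := y) (r := r / 4 / 2 ^ j)
      (s := r / 4 / 2 ^ (j + 1)) (c := 2) (by positivity) (by norm_num) (by norm_num)
      (by rw [pow_succ]; field_simp)
      (ball_subset_ball (div_le_div_of_nonneg_left (by positivity) (by positivity)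
        (pow_le_pow_right₀ (by norm_num) (Nat.le_succ j)))) (hsubU y hy _ hp)
    push_cast
    rw [abs_le] at e1 ih ⊢
    constructor <;> linarith [e1.1, e1.2, ih.1, ih.2]

end MeanOscillation

/-! ### From BMO to doubling. -/

lemma le_two_mul_of_recurrence {Φ : ℕ → ℝ≥0∞} {M a b S : ℝ≥0∞} (hS : S ≠ ∞)
    (hΦ : ∀ j, Φ j ≤ M * b ^ j + a * Φ (j + 1)) (hab : a * b ≤ 2⁻¹) (ha : a ≤ 2⁻¹)
    (hb : ∀ j, Φ j ≤ S) : Φ 0 ≤ 2 * M := by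
  -- After J iterations the main terms are M(ab)ʲ, summing to at most 2M, and the remainder aᴶ Φ J
  -- vanishes in the limit because Φ is bounded by the finite `S`.
  have h1 : ∀ J, Φ 0 ≤ M * ∑ j ∈ Finset.range J, (2⁻¹ : ℝ≥0∞) ^ j + a ^ J * Φ J := by
    intro J
    induction J with
    | zero => simp
    | succ J ih =>
      refine ih.trans ?_
      rw [Finset.sum_range_succ, mul_add, add_assoc]
      gcongr
      calc a ^ J * Φ J ≤ a ^ J * (M * b ^ J + a * Φ (J + 1)) := mul_le_mul_right (hΦ J) _
        _ = M * (a * b) ^ J + a ^ (J + 1) * Φ (J + 1) := by ring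
        _ ≤ _ := by gcongr
  have h2 : ∀ J, Φ 0 ≤ 2 * M + (2⁻¹ : ℝ≥0∞) ^ J * S := by
    intro J
    refine (h1 J).trans ?_
    rw [mul_comm 2 M]
    gcongr
    · refine (ENNReal.sum_le_tsum _).trans ?_
      rw [ENNReal.tsum_geometric, ENNReal.one_sub_inv_two, inv_inv]
    · exact hb J
  have h3 : Tendsto (fun J : ℕ => 2 * M + (2⁻¹ : ℝ≥0∞) ^ J * S) atTop (𝓝 (2 * M + 0 * S)) :=
    tendsto_const_nhds.add (ENNReal.Tendsto.mul_const
      (ENNReal.tendsto_pow_atTop_nhds_zero_of_lt_one (by simp)) (Or.inr hS))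
  simpa using ge_of_tendsto' h3 h2

section Doubling

variable {n : ℕ} {U : Set (EuclideanSpace ℝ (Fin n))} {w : EuclideanSpace ℝ (Fin n) → ℝ}

lemma exists_threshold {q B D κ : ℝ} (hq : 1 < q) (hB : 0 < B) (hD : 0 < D) :
    ∃ l : ℝ, 0 < l ∧ ENNReal.ofReal (D / l ^ 2) ^ (1 - 1 / q) * ENNReal.ofReal B ≤
      ENNReal.ofReal (Real.exp (-κ) / 2) := by
  have hp : 0 < 1 - 1 / q := by
    rw [sub_pos, div_lt_one (by linarith)]; exact hq
  have hX : 0 < 2 * B * Real.exp κ := by positivity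
  set X := 2 * B * Real.exp κ with hXdef
  -- This `l` solves the required inequality with equality.
  refine ⟨√(D * X ^ (1 - 1 / q)⁻¹), by positivity, ?_⟩
  rw [Real.sq_sqrt (by positivity)]
  have h1 : D / (D * X ^ (1 - 1 / q)⁻¹) = X⁻¹ ^ (1 - 1 / q)⁻¹ := by
    rw [Real.inv_rpow hX.le]; field_simp
  rw [h1, ENNReal.ofReal_rpow_of_pos (by positivity), ← Real.rpow_mul (by positivity),
    inv_mul_cancel₀ hp.ne', Real.rpow_one, ← ENNReal.ofReal_mul (by positivity)]
  refine ENNReal.ofReal_le_ofReal (le_of_eq ?_)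
  rw [hXdef, Real.exp_neg]
  field_simp

lemma lintegral_ballMeasure_le_of_weakReverseHolderWith {q B : ℝ} (h : WeakReverseHolderWith w U q B)
    {x : EuclideanSpace ℝ (Fin n)} {r : ℝ} (hr : 0 < r) (hU : ball x (2 * r) ⊆ U) :
    (∫⁻ y, ENNReal.ofReal (w y) ^ q ∂(ballMeasure x r)) ^ (1 / q) ≤
      ENNReal.ofReal B * ∫⁻ y, ENNReal.ofReal (w y) ∂(ballMeasure x (2 * r)) := by
  have := h x r hr hU
  rwa [setLAverage_ball_eq, setLAverage_ball_eq] at this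

/-- The pointwise estimate at scale s = r/(4·2ʲ), integrated over y. With R = 7r/2 the radii are R −
6s, R − 5s and R − 3s: averaging at scale s costs one s on the left, averaging at scale 2s costs two
on the right, and R − 3s is the starting radius of the next stage. -/
lemma setLIntegral_step_le (hw : Measurable w) {q B D l : ℝ} (hq : 1 < q) (hD : 0 ≤ D) (hl : 0 < l)
    (hl' : ENNReal.ofReal (D / l ^ 2) ^ (1 - 1 / q) * ENNReal.ofReal B ≤
      ENNReal.ofReal (Real.exp (-√(D * 4 ^ n)) / 2))
    (hWRH : WeakReverseHolderWith w U q B) (hBMO : IsBMOWith (fun x => Real.log (w x)) U D)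
    {x : EuclideanSpace ℝ (Fin n)} {r : ℝ} (hr : 0 < r) (hU : ball x (4 * r) ⊆ U) (j : ℕ) :
    ∫⁻ y in ball x (7 / 2 * r - 3 / 2 * r / 2 ^ j), ENNReal.ofReal (w y) ≤
      (ENNReal.ofReal (Real.exp (∫ z, Real.log (w z) ∂(ballMeasure x r) + 57 * √(D * 4 ^ n) + l)) *
        volume (ball x (4 * r))) * ENNReal.ofReal (Real.exp √(D * 4 ^ n)) ^ j +
      ENNReal.ofReal (Real.exp (-√(D * 4 ^ n)) / 2) *
        ∫⁻ y in ball x (7 / 2 * r - 3 / 2 * r / 2 ^ (j + 1)), ENNReal.ofReal (w y) := by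
  set κ := √(D * 4 ^ n)
  set m := ∫ z, Real.log (w z) ∂(ballMeasure x r)
  set s := r / 4 / 2 ^ j with hs
  set f := fun y => ENNReal.ofReal (w y)
  have hf : Measurable f := by fun_prop
  have hs0 : 0 < s := by positivity
  have hsr : s ≤ r / 4 := div_le_self (by positivity) (one_le_pow₀ (by norm_num))
  have e0 : 3 / 2 * r / 2 ^ j = 6 * s := by rw [hs]; ring
  have e1 : 3 / 2 * r / 2 ^ (j + 1) = 3 * s := by rw [hs, pow_succ]; ring
  rw [e0, e1]
  have hpt : ∀ y ∈ ball x (7 / 2 * r - 5 * s), ∫⁻ z, f z ∂(ballMeasure y s) ≤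
      ENNReal.ofReal (Real.exp (m + 57 * κ + l)) * ENNReal.ofReal (Real.exp κ) ^ j +
      ENNReal.ofReal (Real.exp (-κ) / 2) * ∫⁻ z, f z ∂(ballMeasure y (2 * s)) := by
    intro y hy
    have hy' : y ∈ ball x (7 / 2 * r) := ball_subset_ball (by linarith) hy
    have hyU : ball y (2 * s) ⊆ U :=
      (ball_subset_ball' (by have := mem_ball.1 hy'; linarith)).trans hU
    have := isProbabilityMeasure_ballMeasure y hs0
    have h1 := lintegral_le_exp_add_rpow (P := ballMeasure y s) hw hq hl
      (lintegral_sq_sub_le_of_isBMOWith hBMO hs0 hyU)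
    have h2 := abs_mean_sub_mean_le_of_mem_ball (Real.measurable_log.comp hw) hD hBMO hr hU hy' j
    have h3 := lintegral_ballMeasure_le_of_weakReverseHolderWith hWRH hs0 hyU
    refine h1.trans (add_le_add ?_ ?_)
    · rw [← ENNReal.ofReal_pow (Real.exp_pos _).le, ← ENNReal.ofReal_mul (Real.exp_pos _).le,
        ← Real.exp_nat_mul, ← Real.exp_add]
      refine ENNReal.ofReal_le_ofReal (Real.exp_le_exp.2 ?_)
      have := (abs_le.1 h2).2
      simp only [Function.comp_def] at this
      linarith
    · calc _ ≤ ENNReal.ofReal (D / l ^ 2) ^ (1 - 1 / q) * (ENNReal.ofReal B *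
            ∫⁻ z, f z ∂(ballMeasure y (2 * s))) := mul_le_mul_right h3 _
        _ ≤ _ := by rw [← mul_assoc]; exact mul_le_mul_left hl' _
  calc ∫⁻ y in ball x (7 / 2 * r - 6 * s), f y
      ≤ ∫⁻ y in ball x (7 / 2 * r - 5 * s), ∫⁻ z, f z ∂(ballMeasure y s) :=
        setLIntegral_le_lintegral_average hf x hs0 (by linarith)
    _ ≤ ∫⁻ y in ball x (7 / 2 * r - 5 * s),
          (ENNReal.ofReal (Real.exp (m + 57 * κ + l)) * ENNReal.ofReal (Real.exp κ) ^ j +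
          ENNReal.ofReal (Real.exp (-κ) / 2) * ∫⁻ z, f z ∂(ballMeasure y (2 * s))) :=
        setLIntegral_mono' measurableSet_ball hpt
    _ = (ENNReal.ofReal (Real.exp (m + 57 * κ + l)) * ENNReal.ofReal (Real.exp κ) ^ j) *
          volume (ball x (7 / 2 * r - 5 * s)) +
          ENNReal.ofReal (Real.exp (-κ) / 2) *
            ∫⁻ y in ball x (7 / 2 * r - 5 * s), ∫⁻ z, f z ∂(ballMeasure y (2 * s)) := by
        rw [lintegral_add_left measurable_const, setLIntegral_const,
          lintegral_const_mul' _ _ ENNReal.ofReal_ne_top]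
    _ ≤ _ := by
        refine add_le_add ?_ (mul_le_mul_right ?_ _)
        · rw [mul_right_comm]
          gcongr
          linarith
        · exact lintegral_average_le_setLIntegral hf x (by positivity) (by linarith)

/-- A weak reverse Hölder weight whose logarithm has bounded mean oscillation is doubling,
quantitatively. -/
lemma isDoublingWith_of_logIsBMOWith (hw : Measurable w)
    (hfin : ∀ (x : EuclideanSpace ℝ (Fin n)) (r : ℝ), closedBall x r ⊆ U →
      ∫⁻ y in ball x r, ENNReal.ofReal (w y) ≠ ∞) {q B D l : ℝ} (hq : 1 < q) (hD : 0 < D)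
    (hl : 0 < l)
    (hl' : ENNReal.ofReal (D / l ^ 2) ^ (1 - 1 / q) * ENNReal.ofReal B ≤
      ENNReal.ofReal (Real.exp (-√(D * 4 ^ n)) / 2))
    (hWRH : WeakReverseHolderWith w U q B) (hBMO : LogIsBMOWith w U D) :
    IsDoublingWith w U (2 * 2 ^ n * Real.exp (57 * √(D * 4 ^ n) + l)) := by
  intro x r hr hU
  rw [setLAverage_ball_eq, setLAverage_ball_eq]
  obtain ⟨hpos, hBMO⟩ := hBMO
  -- Here a = e^{-κ}/2 and b = e^κ, so ab = 1/2. The radii start at 2r and stay below 7r/2, where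
  -- the closed ball still lies in B(x,4r) ⊆ `U` and the integral is finite.
  have hrec := le_two_mul_of_recurrence
    (Φ := fun j => ∫⁻ y in ball x (7 / 2 * r - 3 / 2 * r / 2 ^ j), ENNReal.ofReal (w y))
    (hfin x (7 / 2 * r) ((closedBall_subset_ball (by linarith)).trans hU))
    (setLIntegral_step_le hw hq hD.le hl hl' hWRH hBMO hr hU)
    (by
      rw [← ENNReal.ofReal_mul (by positivity), div_mul_eq_mul_div, ← Real.exp_add]
      simp [ENNReal.ofReal_inv_of_pos])
    (by
      calc _ ≤ ENNReal.ofReal (2⁻¹ : ℝ) := by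
            refine ENNReal.ofReal_le_ofReal ?_
            have : Real.exp (-√(D * 4 ^ n)) ≤ 1 := Real.exp_le_one_iff.2 (by simp)
            linarith
        _ = _ := by simp [ENNReal.ofReal_inv_of_pos])
    (fun j => lintegral_mono_set (ball_subset_ball (by
      have : 0 < 3 / 2 * r / 2 ^ j := by positivity
      linarith)))
  have h2r : 7 / 2 * r - 3 / 2 * r / 2 ^ 0 = 2 * r := by ring
  simp only [h2r] at hrec
  have := isProbabilityMeasure_ballMeasure x hr
  have hsub : ball x r ⊆ U := (ball_subset_ball (by linarith)).trans hU
  have hJ := ofReal_exp_integral_log_le (P := ballMeasure x r) hw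
    ((ballMeasure_absolutelyContinuous x).ae_le (ae_restrict_of_ae_restrict_of_subset hsub hpos))
    ((integrable_ballMeasure hr).2 (hBMO x r hr ((ball_subset_ball (by linarith)).trans hU)).1)
  set m := ∫ z, Real.log (w z) ∂(ballMeasure x r)
  have hv : volume (ball x (4 * r)) = ENNReal.ofReal (2 ^ n) * volume (ball x (2 * r)) := by
    rw [← volume_ball_mul x x two_pos]; ring_nf
  have h2r0 : 0 < 2 * r := by positivity
  calc ∫⁻ y, ENNReal.ofReal (w y) ∂(ballMeasure x (2 * r))
      = (volume (ball x (2 * r)))⁻¹ * ∫⁻ y in ball x (2 * r), ENNReal.ofReal (w y) := by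
        rw [ballMeasure, lintegral_smul_measure, smul_eq_mul]
    _ ≤ _ := mul_le_mul_right hrec _
    _ = ENNReal.ofReal (2 * 2 ^ n * Real.exp (57 * √(D * 4 ^ n) + l)) *
          ENNReal.ofReal (Real.exp m) * ((volume (ball x (2 * r)))⁻¹ * volume (ball x (2 * r))) := by
        rw [hv, ← ENNReal.ofReal_mul (by positivity), mul_assoc (2 * 2 ^ n : ℝ), ← Real.exp_add,
          show 57 * √(D * 4 ^ n) + l + m = m + 57 * √(D * 4 ^ n) + l by ring,
          ENNReal.ofReal_mul (by positivity), ENNReal.ofReal_mul (by positivity)]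
        simp only [ENNReal.ofReal_ofNat]
        ring
    _ = ENNReal.ofReal (2 * 2 ^ n * Real.exp (57 * √(D * 4 ^ n) + l)) *
          ENNReal.ofReal (Real.exp m) := by
        rw [ENNReal.inv_mul_cancel (volume_ball_ne_zero x h2r0) (volume_ball_ne_top x _), mul_one]
    _ ≤ _ := mul_le_mul_right hJ _

end Doubling

/-! ### Lebesgue differentiation, Vitali covering and one step of decay. -/

section Covering

variable {n : ℕ}

lemma ae_tendsto_lintegral_ballMeasure {f : EuclideanSpace ℝ (Fin n) → ℝ≥0∞} (hf : Measurable f)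
    {x : EuclideanSpace ℝ (Fin n)} {ρ s : ℝ} (hs : 0 < s) (hfin : ∫⁻ y in ball x ρ, f y ≠ ∞) :
    ∀ᵐ y, y ∈ ball x ρ →
      Tendsto (fun j : ℕ => ∫⁻ z, f z ∂(ballMeasure y (s / 2 ^ j))) atTop (𝓝 (f y)) := by
  -- Truncation gives a globally finite integral, as the differentiation theorem needs, and changes
  -- no average over small balls around interior points. That theorem uses closed balls; spheres are
  -- null.
  set g := (ball x ρ).indicator f with hg
  have hgm : Measurable g := hf.indicator measurableSet_ball
  have hgi : ∫⁻ y, g y ≠ ∞ := by rwa [hg, lintegral_indicator measurableSet_ball]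
  have hlim : Tendsto (fun j : ℕ => s / 2 ^ j) atTop (𝓝[>] 0) := by
    refine tendsto_nhdsWithin_iff.2 ⟨?_, Eventually.of_forall fun j => by
      simp only [mem_Ioi]; positivity⟩
    have := (tendsto_pow_atTop_nhds_zero_of_lt_one (r := (2⁻¹ : ℝ)) (by norm_num)
      (by norm_num)).const_mul s
    simpa [div_eq_mul_inv] using this
  filter_upwards [(Besicovitch.vitaliFamily volume).ae_tendsto_lintegral_div' hgm hgi]
    with y hy hyx
  have h1 := (hy.comp (Besicovitch.tendsto_filterAt volume y)).comp hlim
  rw [hg, indicator_of_mem hyx] at h1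
  refine h1.congr' ?_
  have hev : ∀ᶠ δ in 𝓝[>] (0 : ℝ), δ < ρ - dist y x :=
    nhdsWithin_le_nhds (Iio_mem_nhds (by have := mem_ball.1 hyx; linarith))
  filter_upwards [hlim.eventually hev] with j hj
  have hj0 : 0 < s / 2 ^ j := by positivity
  have hsub : ball y (s / 2 ^ j) ⊆ ball x ρ := ball_subset_ball' (by linarith)
  have hvol : volume (closedBall y (s / 2 ^ j)) = volume (ball y (s / 2 ^ j)) := by
    rw [Measure.addHaar_closedBall _ _ hj0.le, Measure.addHaar_ball_of_pos _ _ hj0]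
  have hae : ball y (s / 2 ^ j) =ᵐ[volume] closedBall y (s / 2 ^ j) :=
    ae_eq_of_subset_of_measure_ge ball_subset_closedBall hvol.le
      measurableSet_ball.nullMeasurableSet measure_closedBall_lt_top.ne
  simp only [Function.comp_apply]
  rw [hvol, ← setLIntegral_congr hae, ballMeasure, lintegral_smul_measure, smul_eq_mul,
    ENNReal.div_eq_inv_mul]
  congr 1
  refine setLIntegral_congr_fun measurableSet_ball fun z hz => ?_
  exact indicator_of_mem (hsub hz) f

/-- Vitali selects disjoint balls whose fivefold enlargements cover `T`, and `G` fills a proportion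
`c` of each. `T` may be nonmeasurable, since only its outer measure is used. -/
lemma volume_le_of_fraction {G O T : Set (EuclideanSpace ℝ (Fin n))} (hG : MeasurableSet G)
    {R : EuclideanSpace ℝ (Fin n) → ℝ} {s c : ℝ} (hc : 0 < c)
    (hR : ∀ y ∈ T, 0 < R y ∧ R y ≤ s)
    (h : ∀ y ∈ T, ENNReal.ofReal c * volume (ball y (R y)) ≤ volume (G ∩ ball y (R y)))
    (hO : ∀ y ∈ T, ball y (R y) ⊆ O) :
    volume T ≤ ENNReal.ofReal (5 ^ n / c) * volume (G ∩ O) := by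
  obtain ⟨v, hvT, hdisj, hcov⟩ := Vitali.exists_disjoint_subfamily_covering_enlargement_closedBall
    T id R s (fun y hy => (hR y hy).2) 5 (by norm_num)
  simp only [id] at hdisj hcov
  have hdisj' : v.PairwiseDisjoint fun y => ball y (R y) :=
    hdisj.mono fun y => ball_subset_closedBall
  have hcount : v.Countable := hdisj'.countable_of_isOpen (fun _ _ => isOpen_ball)
    fun y hy => ⟨y, mem_ball_self (hR y (hvT hy)).1⟩
  have hsub : T ⊆ ⋃ b ∈ v, closedBall b (5 * R b) := by
    intro y hy
    obtain ⟨b, hb, hyb⟩ := hcov y hy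
    exact mem_biUnion hb (hyb (mem_closedBall_self (hR y hy).1.le))
  have hterm : ∀ b ∈ v, volume (closedBall b (5 * R b)) ≤
      ENNReal.ofReal (5 ^ n / c) * volume (G ∩ ball b (R b)) := by
    intro b hb
    have hRb := (hR b (hvT hb)).1
    have e1 : volume (closedBall b (5 * R b)) = ENNReal.ofReal (5 ^ n) * volume (ball b (R b)) := by
      rw [Measure.addHaar_closedBall _ _ (by positivity),
        ← Measure.addHaar_ball_of_pos _ b (by positivity), volume_ball_mul b b (by norm_num)]
    calc _ = ENNReal.ofReal (5 ^ n / c) * (ENNReal.ofReal c * volume (ball b (R b))) := by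
          rw [e1, ← mul_assoc, ← ENNReal.ofReal_mul (by positivity), div_mul_cancel₀ _ hc.ne']
      _ ≤ _ := mul_le_mul_right (h b (hvT hb)) _
  calc volume T ≤ volume (⋃ b ∈ v, closedBall b (5 * R b)) := measure_mono hsub
    _ ≤ ∑' b : v, volume (closedBall (b : EuclideanSpace ℝ (Fin n)) (5 * R b)) :=
        measure_biUnion_le _ hcount _
    _ ≤ ∑' b : v, ENNReal.ofReal (5 ^ n / c) * volume (G ∩ ball (b : EuclideanSpace ℝ (Fin n)) (R b)) :=
        ENNReal.tsum_le_tsum fun b => hterm b b.2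
    _ = ENNReal.ofReal (5 ^ n / c) * volume (⋃ b ∈ v, G ∩ ball b (R b)) := by
        rw [ENNReal.tsum_mul_left, measure_biUnion hcount
          (hdisj'.mono fun y => inter_subset_right) fun b _ => hG.inter measurableSet_ball]
    _ ≤ _ := by
        refine mul_le_mul_right (measure_mono (iUnion₂_subset fun b hb => ?_)) _
        exact inter_subset_inter_right _ (hO b (hvT hb))

/-- One step of the decay of sublevel sets: a fixed proportion of each stopping ball for the
level `a * t` lies between the levels `a / (2 * A) * t` and `t`. -/
lemma volume_sublevel_inter_ball_le {f : EuclideanSpace ℝ (Fin n) → ℝ≥0∞} (hf : Measurable f)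
    {x : EuclideanSpace ℝ (Fin n)} {ρ ρ' s t a c A : ℝ} (hs : 0 < s) (hρ : ρ' + s ≤ ρ)
    (ht : 0 < t) (ha : 0 < a) (hac : a ≤ c / 2) (hA : 1 ≤ A)
    (hfin : ∫⁻ y in ball x ρ, f y ≠ ∞)
    (hbig : ∀ y ∈ ball x ρ', ENNReal.ofReal (a * t) < ∫⁻ z, f z ∂(ballMeasure y s))
    (hdb : ∀ y ∈ ball x ρ', ∀ R, 0 < R → 2 * R ≤ s →
      ∫⁻ z, f z ∂(ballMeasure y (2 * R)) ≤ ENNReal.ofReal A * ∫⁻ z, f z ∂(ballMeasure y R))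
    (hfrac : ∀ y ∈ ball x ρ', ∀ R, 0 < R → R ≤ s →
      ENNReal.ofReal c ≤ ballMeasure y R {z | (∫⁻ z, f z ∂(ballMeasure y R)) / 2 ≤ f z}) :
    volume ({z | f z < ENNReal.ofReal (a / (2 * A) * t)} ∩ ball x ρ') ≤
      ENNReal.ofReal (5 ^ n / (c / 2)) *
        volume (({z | f z < ENNReal.ofReal t} \ {z | f z < ENNReal.ofReal (a / (2 * A) * t)}) ∩
          ball x ρ) := by
  classical
  have hA0 : 0 < A := by linarith
  set E := {z | f z < ENNReal.ofReal t} with hE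
  set E' := {z | f z < ENNReal.ofReal (a / (2 * A) * t)} with hE'
  have hEm : MeasurableSet E := measurableSet_lt hf measurable_const
  have hEm' : MeasurableSet E' := measurableSet_lt hf measurable_const
  set T := {y | y ∈ E' ∩ ball x ρ' ∧ ∃ R, 0 < R ∧ R ≤ s ∧
    ENNReal.ofReal (c / 2) * volume (ball y R) ≤ volume ((E \ E') ∩ ball y R)} with hT
  have haeT : volume (E' ∩ ball x ρ') ≤ volume T := by
    refine measure_mono_ae ?_
    filter_upwards [ae_tendsto_lintegral_ballMeasure hf hs hfin] with y hlim hy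
    refine ⟨hy, ?_⟩
    have hyρ : y ∈ ball x ρ := ball_subset_ball (by linarith) hy.2
    have hfy : f y < ENNReal.ofReal (a * t) := by
      refine lt_of_lt_of_le hy.1 (ENNReal.ofReal_le_ofReal ?_)
      gcongr
      exact div_le_self ha.le (by linarith)
    -- Stopping time: the averages start above a·t at scale s and tend to f(y) < a·t. At the first
    -- scale below a·t, doubling from the preceding scale keeps the average at least a·t/A.
    have hex : ∃ j : ℕ, ∫⁻ z, f z ∂(ballMeasure y (s / 2 ^ j)) < ENNReal.ofReal (a * t) :=
      ((hlim hyρ).eventually (gt_mem_nhds hfy)).exists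
    set j := Nat.find hex with hj
    have hjs := Nat.find_spec hex
    rw [← hj] at hjs
    have hj0 : j ≠ 0 := by
      intro h0
      rw [h0] at hjs
      simp only [pow_zero, div_one] at hjs
      exact absurd hjs (hbig y hy.2).le.not_gt
    obtain ⟨i, hi⟩ := Nat.exists_eq_succ_of_ne_zero hj0
    have hprev : ENNReal.ofReal (a * t) ≤ ∫⁻ z, f z ∂(ballMeasure y (s / 2 ^ i)) :=
      not_lt.1 (Nat.find_min hex (m := i) (by omega))
    rw [hi, Nat.succ_eq_add_one] at hjs
    have hR0 : 0 < s / 2 ^ (i + 1) := by positivity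
    have h2R : 2 * (s / 2 ^ (i + 1)) = s / 2 ^ i := by rw [pow_succ]; field_simp
    have h2Rs : s / 2 ^ i ≤ s := div_le_self hs.le (one_le_pow₀ (by norm_num))
    set R := s / 2 ^ (i + 1)
    refine ⟨R, hR0, by linarith, ?_⟩
    have hP := isProbabilityMeasure_ballMeasure y hR0
    set P := ballMeasure y R
    have hlow : ENNReal.ofReal (a / (2 * A) * t) ≤ (∫⁻ z, f z ∂P) / 2 := by
      have h1 := hdb y hy.2 R hR0 (by linarith)
      rw [h2R] at h1
      have h2 := hprev.trans h1
      rw [ENNReal.le_div_iff_mul_le (Or.inl (by simp)) (Or.inl (by simp))]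
      refine (ENNReal.mul_le_mul_iff_right (a := ENNReal.ofReal A) (by simpa using hA0)
        ENNReal.ofReal_ne_top).1 (le_trans (le_of_eq ?_) h2)
      rw [← ENNReal.ofReal_ofNat 2, ← ENNReal.ofReal_mul (by positivity),
        ← ENNReal.ofReal_mul hA0.le]
      congr 1
      field_simp
    have hPE' : ENNReal.ofReal c ≤ P E'ᶜ := by
      refine (hfrac y hy.2 R hR0 (by linarith)).trans (measure_mono fun z hz => ?_)
      exact not_lt.2 (hlow.trans hz)
    -- Markov: the stopped average is below a·t, so f ≥ t on a proportion at most a ≤ c/2. Removing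
    -- it from the proportion c above the lower level leaves c/2.
    have hPE : P Eᶜ ≤ ENNReal.ofReal (c / 2) := by
      have hEc : Eᶜ = {z | ENNReal.ofReal t ≤ f z} := by
        ext z; simp [hE]
      rw [hEc]
      refine (meas_ge_le_lintegral_div hf.aemeasurable (by simpa using ht)
        ENNReal.ofReal_ne_top).trans ?_
      refine ENNReal.div_le_of_le_mul (hjs.le.trans ?_)
      rw [← ENNReal.ofReal_mul (by linarith)]
      exact ENNReal.ofReal_le_ofReal (by gcongr)
    have hPD : ENNReal.ofReal (c / 2) ≤ P (E \ E') := by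
      have h1 : P E'ᶜ ≤ P (E \ E') + P Eᶜ := by
        refine (measure_mono fun z hz => ?_).trans (measure_union_le _ _)
        by_cases hzE : z ∈ E
        · exact Or.inl ⟨hzE, hz⟩
        · exact Or.inr hzE
      have h2 : ENNReal.ofReal (c / 2) + ENNReal.ofReal (c / 2) ≤
          P (E \ E') + ENNReal.ofReal (c / 2) := by
        rw [← ENNReal.ofReal_add (by linarith) (by linarith), add_halves]
        exact hPE'.trans (h1.trans (add_le_add_right hPE _))
      exact (ENNReal.add_le_add_iff_right ENNReal.ofReal_ne_top).1 h2
    rw [← ballMeasure_apply y R (hEm.diff hEm'), ENNReal.le_div_iff_mul_le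
      (Or.inl (volume_ball_ne_zero y hR0)) (Or.inl (volume_ball_ne_top y R))] at hPD
    exact hPD
  have hR : ∀ y : EuclideanSpace ℝ (Fin n), ∃ R, y ∈ T → 0 < R ∧ R ≤ s ∧
      ENNReal.ofReal (c / 2) * volume (ball y R) ≤ volume ((E \ E') ∩ ball y R) := by
    intro y
    by_cases hy : y ∈ T
    · obtain ⟨R, h⟩ := hy.2
      exact ⟨R, fun _ => h⟩
    · exact ⟨0, fun h => absurd h hy⟩
  choose R hR using hR
  refine haeT.trans (volume_le_of_fraction (hEm.diff hEm') (by linarith)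
    (fun y hy => ⟨(hR y hy).1, (hR y hy).2.1⟩) (fun y hy => (hR y hy).2.2) fun y hy => ?_)
  refine ball_subset_ball' ?_
  have := mem_ball.1 hy.1.2
  have := (hR y hy).2.1
  linarith

end Covering

/-! ### Consequences of doubling: comparison of averages, positivity, decay of sublevel sets. -/

section DoublingWeights

variable {n : ℕ} {U : Set (EuclideanSpace ℝ (Fin n))} {w : EuclideanSpace ℝ (Fin n) → ℝ} {A : ℝ}

lemma lintegral_ballMeasure_two_mul_le (h : IsDoublingWith w U A) {x : EuclideanSpace ℝ (Fin n)}
    {r : ℝ} (hr : 0 < r) (hU : ball x (4 * r) ⊆ U) :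
    ∫⁻ y, ENNReal.ofReal (w y) ∂(ballMeasure x (2 * r)) ≤
      ENNReal.ofReal A * ∫⁻ y, ENNReal.ofReal (w y) ∂(ballMeasure x r) := by
  have := h x r hr hU
  rwa [setLAverage_ball_eq, setLAverage_ball_eq] at this

lemma lintegral_ballMeasure_le_pow_mul (h : IsDoublingWith w U A) {x : EuclideanSpace ℝ (Fin n)}
    {r : ℝ} (hr : 0 < r) (hU : ball x (2 * r) ⊆ U) (j : ℕ) :
    ∫⁻ y, ENNReal.ofReal (w y) ∂(ballMeasure x r) ≤
      ENNReal.ofReal A ^ j * ∫⁻ y, ENNReal.ofReal (w y) ∂(ballMeasure x (r / 2 ^ j)) := by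
  induction j with
  | zero => simp
  | succ j ih =>
    have h2 : 2 * (r / 2 ^ (j + 1)) = r / 2 ^ j := by rw [pow_succ]; field_simp
    have hle : r / 2 ^ j ≤ r := div_le_self hr.le (one_le_pow₀ (by norm_num))
    have h1 := lintegral_ballMeasure_two_mul_le h (x := x) (r := r / 2 ^ (j + 1)) (by positivity)
      ((ball_subset_ball (by linarith)).trans hU)
    rw [h2] at h1
    refine ih.trans ?_
    rw [pow_succ, mul_assoc]
    exact mul_le_mul_right h1 _

lemma lintegral_ballMeasure_le_of_mem_ball (h : IsDoublingWith w U A)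
    {x y₁ y₂ : EuclideanSpace ℝ (Fin n)} {r : ℝ} (hr : 0 < r) (hU : ball x (2 * r) ⊆ U)
    (h₁ : y₁ ∈ ball x (3 / 2 * r)) (h₂ : y₂ ∈ ball x (3 / 2 * r)) :
    ∫⁻ y, ENNReal.ofReal (w y) ∂(ballMeasure y₁ (r / 8)) ≤
      ENNReal.ofReal ((2 ^ n * A) ^ 24) *
        ∫⁻ y, ENNReal.ofReal (w y) ∂(ballMeasure y₂ (r / 8)) := by
  -- Two centers are less than 3r = 24 · r/8 apart. Doubling at radius r/8 needs B(z, r/2) ⊆ `U`,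
  -- which holds for z in B(x, 3r/2).
  have hchain := le_pow_mul_of_chain (x := x) (R := 3 / 2 * r) (δ := r / 8)
    (K := ENNReal.ofReal (2 ^ n) * ENNReal.ofReal A)
    (φ := fun z => ∫⁻ y, ENNReal.ofReal (w y) ∂(ballMeasure z (r / 8))) (by
      intro z₁ hz₁ z₂ hz₂ hd
      have e1 := lintegral_ballMeasure_le_of_subset (x := z₂) (y := z₁) (r := 2 * (r / 8))
        (s := r / 8) two_pos rfl (ball_subset_ball' (by linarith))
        (fun y => ENNReal.ofReal (w y))
      have e2 := lintegral_ballMeasure_two_mul_le h (x := z₂) (r := r / 8) (by positivity)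
        ((ball_subset_ball' (by have := mem_ball.1 hz₂; linarith)).trans hU)
      rw [mul_assoc]
      exact e1.trans (mul_le_mul_right e2 _)) 24
  rw [← ENNReal.ofReal_mul (by positivity)] at hchain
  have h0 := hchain y₁ h₁ y₂ h₂ (by
    have e1 := mem_ball.1 h₁
    have e2 := mem_ball.1 h₂
    have e3 := dist_triangle_right y₁ y₂ x
    push_cast; linarith)
  refine h0.trans (mul_le_mul_left ?_ _)
  rcases le_total 0 (2 ^ n * A) with hA | hA
  · rw [ENNReal.ofReal_pow hA]
  · simp [ENNReal.ofReal_of_nonpos hA]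

/-- The points of `U` near which `w` vanishes a.e. form an open set, and doubling makes it
relatively closed in `U`. By connectedness it would contain the whole component of x, where `w`
would then vanish a.e. -/
lemma setLIntegral_ne_zero (hU : IsOpen U) (hw : Measurable w) (hw0 : ∀ x, 0 ≤ w x)
    (hcomp : ∀ x ∈ U, ¬ ∀ᵐ y ∂(volume.restrict (connectedComponentIn U x)), w y = 0)
    (h : IsDoublingWith w U A) {x : EuclideanSpace ℝ (Fin n)} (hx : x ∈ U) {r : ℝ} (hr : 0 < r) :
    ∫⁻ y in ball x r, ENNReal.ofReal (w y) ≠ 0 := by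
  intro h0
  have hfm : Measurable fun y => ENNReal.ofReal (w y) := by fun_prop
  set Z := {z | z ∈ U ∧ ∃ s, 0 < s ∧ ∫⁻ y in ball z s, ENNReal.ofReal (w y) = 0} with hZ
  have hmono : ∀ {z z' : EuclideanSpace ℝ (Fin n)} {s s' : ℝ}, ball z' s' ⊆ ball z s →
      ∫⁻ y in ball z s, ENNReal.ofReal (w y) = 0 →
      ∫⁻ y in ball z' s', ENNReal.ofReal (w y) = 0 := fun hsub hz =>
    le_antisymm ((lintegral_mono_set hsub).trans hz.le) bot_le
  have hZo : IsOpen Z := by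
    rw [Metric.isOpen_iff]
    rintro z ⟨hzU, s, hs, hz⟩
    obtain ⟨ε, hε, hεU⟩ := Metric.isOpen_iff.1 hU z hzU
    refine ⟨min ε (s / 2), by positivity, fun z' hz' => ⟨hεU ?_, s / 2, by positivity, ?_⟩⟩
    · exact ball_subset_ball (min_le_left _ _) hz'
    · refine hmono (ball_subset_ball' ?_) hz
      have := (mem_ball.1 hz').trans_le (min_le_right _ _)
      linarith
  have hV : IsOpen (connectedComponentIn U x) := hU.connectedComponentIn
  have hVU : connectedComponentIn U x ⊆ U := connectedComponentIn_subset U x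
  have hVZ : connectedComponentIn U x ⊆ Z := by
    refine isPreconnected_connectedComponentIn.subset_of_closure_inter_subset hZo
      ⟨x, mem_connectedComponentIn hx, hx, r, hr, h0⟩ ?_
    rintro z ⟨hz, hzV⟩
    obtain ⟨ε, hε, hεU⟩ := Metric.isOpen_iff.1 hU z (hVU hzV)
    obtain ⟨z', ⟨hz'U, s, hs, hz'0⟩, hzz'⟩ := Metric.mem_closure_iff.1 hz (ε / 4) (by positivity)
    refine ⟨hVU hzV, ε / 8, by positivity, ?_⟩
    have hεpos : 0 < 3 * ε / 8 := by positivity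
    have hlim : Tendsto (fun j : ℕ => 3 * ε / 8 / 2 ^ j) atTop (𝓝 0) := by
      have := (tendsto_pow_atTop_nhds_zero_of_lt_one (r := (2⁻¹ : ℝ)) (by norm_num)
        (by norm_num)).const_mul (3 * ε / 8)
      simpa [div_eq_mul_inv] using this
    obtain ⟨j, hj⟩ := (hlim.eventually (gt_mem_nhds hs)).exists
    -- Doubling spreads the zero from a tiny ball around z' to B(z', 3ε/8), which contains B(z, ε/8)
    -- because z' is within ε/4 of z.
    have h1 := lintegral_ballMeasure_le_pow_mul h (x := z') hεpos
      ((ball_subset_ball' (by rw [dist_comm]; linarith)).trans hεU) j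
    have h2 : ∫⁻ y, ENNReal.ofReal (w y) ∂(ballMeasure z' (3 * ε / 8 / 2 ^ j)) = 0 := by
      rw [ballMeasure, lintegral_smul_measure, hmono (ball_subset_ball hj.le) hz'0, smul_zero]
    rw [h2, mul_zero, nonpos_iff_eq_zero] at h1
    have h3 := setLIntegral_ball_eq (fun y => ENNReal.ofReal (w y)) z' hεpos
    rw [h1, mul_zero] at h3
    exact hmono (ball_subset_ball' (by linarith)) h3
  refine hcomp x hx ?_
  rw [ae_restrict_iff' hV.measurableSet, ae_iff]
  refine measure_null_of_locally_null _ fun z hz => ?_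
  simp only [Classical.not_imp, mem_ofPred_eq] at hz
  obtain ⟨-, s, hs, hzs⟩ := hVZ hz.1
  rw [lintegral_eq_zero_iff hfm, EventuallyEq, ae_restrict_iff' measurableSet_ball, ae_iff] at hzs
  refine ⟨_, inter_mem_nhdsWithin _ (ball_mem_nhds z hs), measure_mono_null ?_ hzs⟩
  rintro y ⟨hy, hyb⟩
  simp only [Classical.not_imp, mem_ofPred_eq, Pi.zero_apply, ENNReal.ofReal_eq_zero] at hy ⊢
  exact ⟨hyb, fun hle => hy.2 (le_antisymm hle (hw0 y))⟩

/-- Geometric decay of the measure of sublevel sets of a doubling weak reverse Hölder weight. -/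
lemma volume_sublevel_le_pow (hw : Measurable w)
    (hfin : ∀ (x : EuclideanSpace ℝ (Fin n)) (r : ℝ), closedBall x r ⊆ U →
      ∫⁻ y in ball x r, ENNReal.ofReal (w y) ≠ ∞)
    (hne : ∀ x ∈ U, ∀ r, 0 < r → ∫⁻ y in ball x r, ENNReal.ofReal (w y) ≠ 0)
    {q B : ℝ} (hq : 1 < q) (hB : 0 < B) (hA : 1 ≤ A)
    (hWRH : WeakReverseHolderWith w U q B) (h : IsDoublingWith w U A)
    {c a H : ℝ} (hc : c = (2 * (B * A))⁻¹ ^ (1 - 1 / q)⁻¹)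
    (ha : a = min (c / 2) (2 * (2 ^ n * A) ^ 24)⁻¹) (hH : H = 5 ^ n / (c / 2))
    {x : EuclideanSpace ℝ (Fin n)} {r τ : ℝ} (hr : 0 < r) (hU : ball x (2 * r) ⊆ U) (hτ : 0 < τ)
    (hτ' : ENNReal.ofReal τ = ∫⁻ y, ENNReal.ofReal (w y) ∂(ballMeasure x (r / 8))) (k : ℕ) :
    volume ({z | ENNReal.ofReal (w z) < ENNReal.ofReal (τ * (a / (2 * A)) ^ k)} ∩ ball x r) ≤
      ENNReal.ofReal ((H / (1 + H)) ^ k) * volume (ball x (2 * r)) := by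
  have hA0 : 0 < A := by linarith
  have hc0 : 0 < c := by rw [hc]; positivity
  have hL : 0 < (2 ^ n * A) ^ 24 := by positivity
  have ha0 : 0 < a := by rw [ha]; positivity
  have hac : a ≤ c / 2 := by rw [ha]; exact min_le_left _ _
  have haL : a ≤ (2 * (2 ^ n * A) ^ 24)⁻¹ := by rw [ha]; exact min_le_right _ _
  have hH0 : 0 < H := by rw [hH]; positivity
  have ha1 : a ≤ 1 := by
    refine haL.trans (inv_le_one_of_one_le₀ ?_)
    have : 1 ≤ (2 ^ n * A) ^ 24 :=
      one_le_pow₀ (one_le_mul_of_one_le_of_one_le (one_le_pow₀ (by norm_num)) hA)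
    linarith
  set β := a / (2 * A) with hβ
  have hβ0 : 0 < β := by positivity
  have hβA : β ≤ A⁻¹ := by
    rw [hβ, div_le_iff₀ (by positivity)]
    have : A⁻¹ * (2 * A) = 2 := by field_simp
    linarith
  have hβ1 : β ≤ 1 := hβA.trans (inv_le_one_of_one_le₀ hA)
  set f := fun y => ENNReal.ofReal (w y) with hf
  have hfm : Measurable f := by fun_prop
  have hmem : ∀ y ∈ ball x (3 / 2 * r), ∀ t ≤ r / 2, ball y t ⊆ U := fun y hy t ht =>
    (ball_subset_ball' (by have := mem_ball.1 hy; linarith)).trans hU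
  have hav : ∀ y ∈ ball x (3 / 2 * r), ∀ R, 0 < R → R ≤ r / 4 →
      ∫⁻ z, f z ∂(ballMeasure y R) ≠ 0 ∧ ∫⁻ z, f z ∂(ballMeasure y R) ≠ ∞ := by
    intro y hy R hR hRr
    rw [ballMeasure, lintegral_smul_measure, smul_eq_mul]
    refine ⟨mul_ne_zero (ENNReal.inv_ne_zero.2 (volume_ball_ne_top y R)) (hne y ?_ R hR),
      ENNReal.mul_ne_top (ENNReal.inv_ne_top.2 (volume_ball_ne_zero y hR)) (hfin y R ?_)⟩
    · exact hmem y hy (r / 2) le_rfl (mem_ball_self (by positivity))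
    · exact (closedBall_subset_ball (by linarith)).trans (hmem y hy (r / 2) le_rfl)
  -- Each covering step shrinks the ball, so the induction runs on radii r + r/(4·2ᵏ), with stopping
  -- radii at most s = r/(8·2ᵏ).
  have key : ∀ k : ℕ,
      volume ({z | f z < ENNReal.ofReal (τ * β ^ k)} ∩ ball x (r + r / 4 / 2 ^ k)) ≤
      ENNReal.ofReal ((H / (1 + H)) ^ k) * volume (ball x (2 * r)) := by
    intro k
    induction k with
    | zero =>
      simp only [pow_zero, ENNReal.ofReal_one, one_mul]
      exact measure_mono (inter_subset_right.trans (ball_subset_ball (by linarith)))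
    | succ k ih =>
      have hs0 : 0 < r / 8 / 2 ^ k := by positivity
      have hsr : r / 8 / 2 ^ k ≤ r / 8 := div_le_self (by positivity) (one_le_pow₀ (by norm_num))
      set s := r / 8 / 2 ^ k with hs
      have e1 : r / 4 / 2 ^ (k + 1) = s := by rw [hs, pow_succ]; field_simp; norm_num
      have e2 : r / 4 / 2 ^ k = 2 * s := by rw [hs]; ring
      rw [e1]
      rw [e2] at ih
      have hsub : ∀ y ∈ ball x (r + s), y ∈ ball x (3 / 2 * r) := fun y hy =>
        ball_subset_ball (by linarith) hy
      have hstep := volume_sublevel_inter_ball_le hfm (x := x) (ρ := r + 2 * s) (ρ' := r + s)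
        (s := s) (t := τ * β ^ k) (a := a) (c := c) (A := A) hs0 (by linarith) (by positivity)
        ha0 hac hA (hfin x _ ((closedBall_subset_ball (by linarith)).trans hU))
        (by
          intro y hy
          have hy' := hsub y hy
          obtain ⟨hv0, hvT⟩ := hav y hy' s hs0 (by linarith)
          have e3 := lintegral_ballMeasure_le_of_mem_ball h (x := x) (y₁ := x) (y₂ := y) hr hU
            (mem_ball_self (by positivity)) hy'
          have e4 := lintegral_ballMeasure_le_pow_mul h (x := y) (r := r / 8) (by positivity)
            (hmem y hy' _ (by linarith)) k
          rw [← hτ'] at e3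
          have e5 := e3.trans (mul_le_mul_right e4 _)
          rw [← hs, ← mul_assoc, ← ENNReal.ofReal_pow hA0.le, ← ENNReal.ofReal_mul hL.le] at e5
          -- Halving the initial scale k times costs at most Aᵏ in the average, and β ≤ 1/A lowers
          -- the level at least as fast. The factor (2ⁿA)²⁴ in `a` pays for moving the center, and
          -- the factor 2 makes the inequality strict.
          calc ENNReal.ofReal (a * (τ * β ^ k))
              ≤ ENNReal.ofReal ((2 * ((2 ^ n * A) ^ 24 * A ^ k))⁻¹ * τ) := by
                refine ENNReal.ofReal_le_ofReal ?_
                have : a * β ^ k ≤ (2 * (2 ^ n * A) ^ 24)⁻¹ * (A⁻¹) ^ k := by gcongr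
                calc a * (τ * β ^ k) = (a * β ^ k) * τ := by ring
                  _ ≤ ((2 * (2 ^ n * A) ^ 24)⁻¹ * (A⁻¹) ^ k) * τ := by gcongr
                  _ = _ := by rw [inv_pow, ← mul_inv, mul_assoc]
            _ = ENNReal.ofReal (2 * ((2 ^ n * A) ^ 24 * A ^ k))⁻¹ * ENNReal.ofReal τ :=
                ENNReal.ofReal_mul (by positivity)
            _ ≤ ENNReal.ofReal (2 * ((2 ^ n * A) ^ 24 * A ^ k))⁻¹ *
                  (ENNReal.ofReal ((2 ^ n * A) ^ 24 * A ^ k) * ∫⁻ z, f z ∂(ballMeasure y s)) :=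
                mul_le_mul_right e5 _
            _ = 2⁻¹ * ∫⁻ z, f z ∂(ballMeasure y s) := by
                rw [← mul_assoc, ← ENNReal.ofReal_mul (by positivity)]
                congr 1
                rw [mul_inv, inv_mul_cancel_right₀ (by positivity),
                  ENNReal.ofReal_inv_of_pos two_pos, ENNReal.ofReal_ofNat]
            _ < ∫⁻ z, f z ∂(ballMeasure y s) := by
                rw [mul_comm, ← div_eq_mul_inv]
                exact ENNReal.half_lt_self hv0 hvT)
        (by
          intro y hy R hR hRs
          exact lintegral_ballMeasure_two_mul_le h hR (hmem y (hsub y hy) _ (by linarith)))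
        (by
          intro y hy R hR hRs
          have hy' := hsub y hy
          obtain ⟨hv0, hvT⟩ := hav y hy' R hR (by linarith)
          have := isProbabilityMeasure_ballMeasure y hR
          rw [hc]
          refine ofReal_rpow_le_measure hfm hq (by positivity) hv0 hvT ?_
          have e3 := lintegral_ballMeasure_le_of_weakReverseHolderWith hWRH hR
            (hmem y hy' _ (by linarith))
          have e4 := lintegral_ballMeasure_two_mul_le h hR (hmem y hy' _ (by linarith))
          refine e3.trans ((mul_le_mul_right e4 _).trans_eq ?_)
          rw [← mul_assoc, ← ENNReal.ofReal_mul hB.le])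
      rw [← hβ, ← hH, show β * (τ * β ^ k) = τ * β ^ (k + 1) by ring] at hstep
      set E := {z | f z < ENNReal.ofReal (τ * β ^ k)}
      set E' := {z | f z < ENNReal.ofReal (τ * β ^ (k + 1))}
      have hE'm : MeasurableSet E' := measurableSet_lt hfm measurable_const
      have hEE : E' ⊆ E := fun z hz => lt_of_lt_of_le hz (ENNReal.ofReal_le_ofReal (by
        rw [pow_succ, ← mul_assoc]; exact mul_le_of_le_one_right (by positivity) hβ1))
      set X := volume (E' ∩ ball x (r + s))
      have hsum : volume ((E \ E') ∩ ball x (r + 2 * s)) + X ≤ volume (E ∩ ball x (r + 2 * s)) := by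
        refine (measure_union (disjoint_left.2 fun z hz hz' => hz.1.2 hz'.1)
          (hE'm.inter measurableSet_ball)).symm.trans_le (measure_mono (union_subset
            (inter_subset_inter_left _ sdiff_subset)
            (inter_subset_inter hEE (ball_subset_ball (by linarith)))))
      -- Hole filling: adding H·|E'| to |E'| ≤ H·|E \ E'| gives the ratio H/(1 + H) < 1.
      have h1 : ENNReal.ofReal (1 + H) * X ≤ ENNReal.ofReal H *
          volume (E ∩ ball x (r + 2 * s)) := by
        calc ENNReal.ofReal (1 + H) * X = X + ENNReal.ofReal H * X := by
              rw [ENNReal.ofReal_add zero_le_one hH0.le, add_mul, ENNReal.ofReal_one, one_mul]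
          _ ≤ ENNReal.ofReal H * volume ((E \ E') ∩ ball x (r + 2 * s)) + ENNReal.ofReal H * X :=
              add_le_add_left hstep _
          _ ≤ _ := by rw [← mul_add]; exact mul_le_mul_right hsum _
      have hone : (1 + H)⁻¹ * (1 + H) = 1 := inv_mul_cancel₀ (by positivity)
      calc X = ENNReal.ofReal (1 + H)⁻¹ * (ENNReal.ofReal (1 + H) * X) := by
            rw [← mul_assoc, ← ENNReal.ofReal_mul (by positivity), hone, ENNReal.ofReal_one, one_mul]
        _ ≤ ENNReal.ofReal (1 + H)⁻¹ * (ENNReal.ofReal H *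
              (ENNReal.ofReal ((H / (1 + H)) ^ k) * volume (ball x (2 * r)))) :=
            mul_le_mul_right (h1.trans (mul_le_mul_right ih _)) _
        _ = _ := by
            rw [← mul_assoc, ← mul_assoc, ← ENNReal.ofReal_mul (by positivity),
              ← ENNReal.ofReal_mul (by positivity), pow_succ]
            congr 2
            rw [div_eq_mul_inv]; ring
  refine (measure_mono (inter_subset_inter_right _ (ball_subset_ball ?_))).trans (key k)
  have : 0 < r / 4 / 2 ^ k := by positivity
  linarith

end DoublingWeights

/-! ### From decay of sublevel sets to the oscillation of the logarithm. -/

lemma sq_log_le_four_mul {y : ℝ} (hy : 1 ≤ y) : Real.log y ^ 2 ≤ 4 * y := by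
  have hy0 : 0 < y := by linarith
  have h1 : Real.log y = 2 * Real.log √y := by rw [Real.log_sqrt hy0.le]; ring
  have h2 : Real.log √y ≤ √y := (Real.log_le_sub_one_of_pos (Real.sqrt_pos.2 hy0)).trans (by linarith)
  have h3 : 0 ≤ Real.log √y := Real.log_nonneg (Real.one_le_sqrt.2 hy)
  have h4 : √y ^ 2 = y := Real.sq_sqrt hy0.le
  rw [h1]
  nlinarith [pow_le_pow_left₀ h3 h2 2]

lemma sq_log_sub_log_le {Ω : Type*} (w : Ω → ℝ) {τ β : ℝ} (hτ : 0 < τ) (hβ : 0 < β) (hβ1 : β < 1)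
    {x : Ω} (hx : 0 < w x) :
    ENNReal.ofReal (|Real.log (w x) - Real.log τ| ^ 2) ≤
      ENNReal.ofReal (4 / τ) * ENNReal.ofReal (w x) +
      ∑' k : ℕ, ENNReal.ofReal ((Real.log β * (k + 1)) ^ 2) *
        {z | ENNReal.ofReal (w z) < ENNReal.ofReal (τ * β ^ k)}.indicator 1 x := by
  rw [← Real.log_div hx.ne' hτ.ne', sq_abs]
  rcases le_or_gt τ (w x) with hle | hlt
  · refine le_trans ?_ le_self_add
    rw [← ENNReal.ofReal_mul (by positivity)]
    refine ENNReal.ofReal_le_ofReal ((sq_log_le_four_mul ((one_le_div hτ).2 hle)).trans_eq ?_)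
    ring
  · refine le_trans ?_ le_add_self
    have hL : 0 < -Real.log β := neg_pos.2 (Real.log_neg hβ hβ1)
    have ha : 0 < -Real.log (w x / τ) := neg_pos.2 (Real.log_neg (by positivity)
      ((div_lt_one hτ).2 hlt))
    -- This k satisfies τβᵏ⁺¹ ≤ w(x) < τβᵏ, so the k-th term of the series alone suffices.
    obtain ⟨k, hk⟩ : ∃ k, ⌈-Real.log (w x / τ) / -Real.log β⌉₊ = k + 1 :=
      Nat.exists_eq_succ_of_ne_zero (Nat.ceil_pos.2 (div_pos ha hL)).ne'
    have hk1 : (k : ℝ) < -Real.log (w x / τ) / -Real.log β := Nat.lt_ceil.1 (by omega)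
    have hk2 : -Real.log (w x / τ) / -Real.log β ≤ k + 1 := by
      have := Nat.le_ceil (-Real.log (w x / τ) / -Real.log β)
      rw [hk] at this
      exact_mod_cast this
    rw [lt_div_iff₀ hL] at hk1
    rw [div_le_iff₀ hL] at hk2
    refine le_trans ?_ (ENNReal.le_tsum k)
    have hmem : x ∈ {z | ENNReal.ofReal (w z) < ENNReal.ofReal (τ * β ^ k)} := by
      refine (ENNReal.ofReal_lt_ofReal_iff (by positivity)).2 ?_
      rw [← div_lt_iff₀' hτ, ← Real.log_lt_log_iff (by positivity) (by positivity), Real.log_pow]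
      linarith
    rw [indicator_of_mem hmem, Pi.one_apply, mul_one]
    rw [← neg_sq (Real.log (w x / τ)), ← neg_sq (Real.log β * _)]
    exact ENNReal.ofReal_le_ofReal (pow_le_pow_left₀ ha.le (by linarith) 2)

section

variable {n : ℕ} {U : Set (EuclideanSpace ℝ (Fin n))} {w : EuclideanSpace ℝ (Fin n) → ℝ}

lemma setLIntegral_sq_log_sub_log_le (hw : Measurable w) {x : EuclideanSpace ℝ (Fin n)}
    {r τ β θ L : ℝ} (hτ : 0 < τ) (hβ : 0 < β) (hβ1 : β < 1) (hθ : 0 ≤ θ) (hθ1 : θ < 1)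
    (hL : 0 ≤ L) (hr : 0 < r)
    (hpos : ∀ᵐ y ∂(volume.restrict (ball x r)), 0 < w y)
    (hint : ∫⁻ y in ball x r, ENNReal.ofReal (w y) ≤
      ENNReal.ofReal (L * τ) * volume (ball x (2 * r)))
    (hdecay : ∀ k : ℕ,
      volume ({z | ENNReal.ofReal (w z) < ENNReal.ofReal (τ * β ^ k)} ∩ ball x r) ≤
        ENNReal.ofReal (θ ^ k) * volume (ball x (2 * r))) :
    ∫⁻ y, ENNReal.ofReal (|Real.log (w y) - Real.log τ| ^ 2) ∂(ballMeasure x r) ≤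
      ENNReal.ofReal (2 ^ n * (4 * L + ∑' k : ℕ, (Real.log β * (k + 1)) ^ 2 * θ ^ k)) := by
  have hsum : Summable fun k : ℕ => (Real.log β * (k + 1)) ^ 2 * θ ^ k := by
    have hθn : ‖θ‖ < 1 := by rwa [Real.norm_of_nonneg hθ]
    have h0 := summable_pow_mul_geometric_of_norm_lt_one 0 hθn
    have h1 := summable_pow_mul_geometric_of_norm_lt_one 1 hθn
    have h2 := summable_pow_mul_geometric_of_norm_lt_one 2 hθn
    refine (((h2.add (h1.mul_left 2)).add h0).mul_left (Real.log β ^ 2)).congr fun k => ?_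
    ring
  have hS : ∀ k, MeasurableSet {z | ENNReal.ofReal (w z) < ENNReal.ofReal (τ * β ^ k)} := fun k =>
    measurableSet_lt (by fun_prop) measurable_const
  have h1 : ∫⁻ y in ball x r, ENNReal.ofReal (|Real.log (w y) - Real.log τ| ^ 2) ≤
      ENNReal.ofReal (4 * L + ∑' k : ℕ, (Real.log β * (k + 1)) ^ 2 * θ ^ k) *
        volume (ball x (2 * r)) := by
    calc _ ≤ ∫⁻ y in ball x r, (ENNReal.ofReal (4 / τ) * ENNReal.ofReal (w y) +
          ∑' k : ℕ, ENNReal.ofReal ((Real.log β * (k + 1)) ^ 2) *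
            {z | ENNReal.ofReal (w z) < ENNReal.ofReal (τ * β ^ k)}.indicator 1 y) :=
          lintegral_mono_ae (hpos.mono fun y hy => sq_log_sub_log_le w hτ hβ hβ1 hy)
      _ = ENNReal.ofReal (4 / τ) * (∫⁻ y in ball x r, ENNReal.ofReal (w y)) +
          ∑' k : ℕ, ENNReal.ofReal ((Real.log β * (k + 1)) ^ 2) *
            volume ({z | ENNReal.ofReal (w z) < ENNReal.ofReal (τ * β ^ k)} ∩ ball x r) := by
          rw [lintegral_add_left (hw.ennreal_ofReal.const_mul _), lintegral_const_mul' _ _ ENNReal.ofReal_ne_top,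
            lintegral_tsum fun k =>
              ((measurable_one.indicator (hS k)).const_mul _).aemeasurable]
          congr 1
          refine tsum_congr fun k => ?_
          rw [lintegral_const_mul' _ _ ENNReal.ofReal_ne_top, lintegral_indicator_one (hS k),
            Measure.restrict_apply (hS k)]
      _ ≤ ENNReal.ofReal (4 / τ) * (ENNReal.ofReal (L * τ) * volume (ball x (2 * r))) +
          ∑' k : ℕ, ENNReal.ofReal ((Real.log β * (k + 1)) ^ 2) *
            (ENNReal.ofReal (θ ^ k) * volume (ball x (2 * r))) :=
          add_le_add (mul_le_mul_right hint _)
            (ENNReal.tsum_le_tsum fun k => mul_le_mul_right (hdecay k) _)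
      _ = _ := by
          rw [ENNReal.ofReal_add (by positivity) (tsum_nonneg fun k => by positivity), add_mul,
            ENNReal.ofReal_tsum_of_nonneg (fun k => by positivity) hsum, ← ENNReal.tsum_mul_right,
            ← mul_assoc, ← ENNReal.ofReal_mul (by positivity)]
          congr 1
          · congr 2
            field_simp
          · refine tsum_congr fun k => ?_
            rw [← mul_assoc, ← ENNReal.ofReal_mul (by positivity)]
  rw [ballMeasure, lintegral_smul_measure, smul_eq_mul]
  refine (mul_le_mul_right h1 _).trans_eq ?_
  rw [volume_ball_mul x x two_pos, ENNReal.ofReal_mul (p := 2 ^ n) (by positivity)]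
  calc _ = ENNReal.ofReal (2 ^ n) *
        ENNReal.ofReal (4 * L + ∑' k : ℕ, (Real.log β * (k + 1)) ^ 2 * θ ^ k) *
        ((volume (ball x r))⁻¹ * volume (ball x r)) := by ring
    _ = _ := by
      rw [ENNReal.inv_mul_cancel (volume_ball_ne_zero x hr) (volume_ball_ne_top x r), mul_one]

end

/-! ### Doubling implies BMO, and reduction to measurable weights. -/

section

variable {n : ℕ} {U : Set (EuclideanSpace ℝ (Fin n))} {w w' : EuclideanSpace ℝ (Fin n) → ℝ}

/-- A doubling weak reverse Hölder weight with positive integrals over balls has a logarithm of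
bounded mean oscillation. -/
lemma logIsBMO_of_isDoublingWith (hw : Measurable w)
    (hfin : ∀ (x : EuclideanSpace ℝ (Fin n)) (r : ℝ), closedBall x r ⊆ U →
      ∫⁻ y in ball x r, ENNReal.ofReal (w y) ≠ ∞) (hU : IsOpen U)
    (hne : ∀ x ∈ U, ∀ r, 0 < r → ∫⁻ y in ball x r, ENNReal.ofReal (w y) ≠ 0)
    {q B A : ℝ} (hq : 1 < q) (hB : 0 < B) (hA : 1 ≤ A)
    (hWRH : WeakReverseHolderWith w U q B) (h : IsDoublingWith w U A) : LogIsBMO w U := by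
  have hA0 : 0 < A := by linarith
  obtain ⟨c, hc⟩ : ∃ c, c = (2 * (B * A))⁻¹ ^ (1 - 1 / q)⁻¹ := ⟨_, rfl⟩
  obtain ⟨a, ha⟩ : ∃ a, a = min (c / 2) (2 * (2 ^ n * A) ^ 24)⁻¹ := ⟨_, rfl⟩
  obtain ⟨H, hH⟩ : ∃ H, H = 5 ^ n / (c / 2) := ⟨_, rfl⟩
  have hc0 : 0 < c := by rw [hc]; positivity
  have ha0 : 0 < a := by rw [ha]; positivity
  have hH0 : 0 < H := by rw [hH]; positivity
  have hL1 : 1 ≤ (2 ^ n * A) ^ 24 :=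
    one_le_pow₀ (one_le_mul_of_one_le_of_one_le (one_le_pow₀ (by norm_num)) hA)
  have ha1 : a ≤ 1 := by
    rw [ha]
    exact (min_le_right _ _).trans (inv_le_one_of_one_le₀ (by linarith))
  have hβ0 : 0 < a / (2 * A) := by positivity
  have hβ1 : a / (2 * A) < 1 := by
    rw [div_lt_one (by positivity)]; linarith
  have hθ0 : 0 ≤ H / (1 + H) := by positivity
  have hθ1 : H / (1 + H) < 1 := by
    rw [div_lt_one (by positivity)]; linarith
  have hball : ∀ (x : EuclideanSpace ℝ (Fin n)) (r : ℝ), 0 < r → ball x (2 * r) ⊆ U →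
      ∃ τ, 0 < τ ∧
        ENNReal.ofReal τ = ∫⁻ y, ENNReal.ofReal (w y) ∂(ballMeasure x (r / 8)) ∧
        ∀ k : ℕ, volume ({z | ENNReal.ofReal (w z) < ENNReal.ofReal (τ * (a / (2 * A)) ^ k)} ∩
          ball x r) ≤ ENNReal.ofReal ((H / (1 + H)) ^ k) * volume (ball x (2 * r)) := by
    intro x r hr hxU
    have hr8 : 0 < r / 8 := by positivity
    have hT : ∫⁻ y, ENNReal.ofReal (w y) ∂(ballMeasure x (r / 8)) ≠ ∞ := by
      rw [ballMeasure, lintegral_smul_measure, smul_eq_mul]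
      exact ENNReal.mul_ne_top (ENNReal.inv_ne_top.2 (volume_ball_ne_zero x hr8))
        (hfin x _ ((closedBall_subset_ball (by linarith)).trans hxU))
    have h0 : ∫⁻ y, ENNReal.ofReal (w y) ∂(ballMeasure x (r / 8)) ≠ 0 := by
      rw [ballMeasure, lintegral_smul_measure, smul_eq_mul]
      exact mul_ne_zero (ENNReal.inv_ne_zero.2 (volume_ball_ne_top x _))
        (hne x (hxU (mem_ball_self (by positivity))) _ hr8)
    have hτ := ENNReal.toReal_pos h0 hT
    exact ⟨_, hτ, ENNReal.ofReal_toReal hT, volume_sublevel_le_pow hw hfin hne hq hB hA hWRH h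
      hc ha hH hr hxU hτ (ENNReal.ofReal_toReal hT)⟩
  -- Points where `w` is not positive lie in every sublevel set, whose measures tend to 0.
  have hnull : ∀ (x : EuclideanSpace ℝ (Fin n)) (r : ℝ), 0 < r → ball x (2 * r) ⊆ U →
      volume ({z | ¬ 0 < w z} ∩ ball x r) = 0 := by
    intro x r hr hxU
    obtain ⟨τ, hτ, -, hdec⟩ := hball x r hr hxU
    have hlim : Tendsto (fun k : ℕ => ENNReal.ofReal ((H / (1 + H)) ^ k) * volume (ball x (2 * r)))
        atTop (𝓝 (ENNReal.ofReal 0 * volume (ball x (2 * r)))) :=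
      ENNReal.Tendsto.mul_const
        (ENNReal.tendsto_ofReal (tendsto_pow_atTop_nhds_zero_of_lt_one hθ0 hθ1))
        (Or.inr (volume_ball_ne_top _ _))
    rw [ENNReal.ofReal_zero, zero_mul] at hlim
    refine le_antisymm (ge_of_tendsto' hlim fun k => (measure_mono ?_).trans (hdec k)) bot_le
    refine inter_subset_inter_left _ fun z hz => ?_
    have hz' : w z ≤ 0 := not_lt.1 hz
    show ENNReal.ofReal (w z) < _
    rw [ENNReal.ofReal_of_nonpos hz']
    exact ENNReal.ofReal_pos.2 (by positivity)
  have hposU : ∀ᵐ x ∂(volume.restrict U), 0 < w x := by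
    rw [ae_restrict_iff' hU.measurableSet, ae_iff]
    refine measure_null_of_locally_null _ fun z hz => ?_
    simp only [Classical.not_imp, mem_ofPred_eq] at hz
    obtain ⟨ε, hε, hεU⟩ := Metric.isOpen_iff.1 hU z hz.1
    have hε2 : 0 < ε / 2 := by positivity
    refine ⟨_, inter_mem_nhdsWithin _ (ball_mem_nhds z hε2), measure_mono_null ?_
      (hnull z (ε / 2) hε2 ((ball_subset_ball (by linarith)).trans hεU))⟩
    rintro y ⟨hy, hyb⟩
    simp only [Classical.not_imp, mem_ofPred_eq] at hy
    exact ⟨hy.2, hyb⟩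
  set S := ∑' k : ℕ, (Real.log (a / (2 * A)) * (k + 1)) ^ 2 * (H / (1 + H)) ^ k
  have hS : 0 ≤ S := tsum_nonneg fun k => by positivity
  refine ⟨4 * (2 ^ n * (4 * (2 ^ n * A) ^ 24 + S)), by positivity, hposU, fun x r hr hxU => ?_⟩
  obtain ⟨τ, hτ, hτ', hdec⟩ := hball x r hr hxU
  -- The integral is dominated by that of the averages at scale r/8, each comparable to τ by the
  -- chain.
  have hint : ∫⁻ y in ball x r, ENNReal.ofReal (w y) ≤
      ENNReal.ofReal ((2 ^ n * A) ^ 24 * τ) * volume (ball x (2 * r)) := by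
    calc _ ≤ ∫⁻ y in ball x (9 / 8 * r), ∫⁻ z, ENNReal.ofReal (w z) ∂(ballMeasure y (r / 8)) :=
          setLIntegral_le_lintegral_average hw.ennreal_ofReal x (by positivity) (by linarith)
      _ ≤ ∫⁻ y in ball x (9 / 8 * r), ENNReal.ofReal ((2 ^ n * A) ^ 24 * τ) := by
          refine setLIntegral_mono' measurableSet_ball fun y hy => ?_
          rw [ENNReal.ofReal_mul (by positivity), hτ']
          exact lintegral_ballMeasure_le_of_mem_ball h hr hxU
            (ball_subset_ball (by linarith) hy) (mem_ball_self (by positivity))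
      _ ≤ _ := by
          rw [setLIntegral_const]
          exact mul_le_mul_right (measure_mono (ball_subset_ball (by linarith))) _
  have hsub : ball x r ⊆ U := (ball_subset_ball (by linarith)).trans hxU
  have hosc := setLIntegral_sq_log_sub_log_le hw hτ hβ0 hβ1 hθ0 hθ1 (by positivity) hr
    (ae_restrict_of_ae_restrict_of_subset hsub hposU) hint hdec
  have := isProbabilityMeasure_ballMeasure x hr
  obtain ⟨hi, hle⟩ := sq_sub_integral_le (u := fun y => Real.log (w y))
    (Real.measurable_log.comp hw).aestronglyMeasurable hosc
  refine ⟨(integrable_ballMeasure hr).1 hi, ?_⟩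
  rw [setLAverage_ball_eq, setAverage_ball_eq]
  exact hle

lemma isDoublingWith_congr (hww : w =ᵐ[volume.restrict U] w') {A : ℝ} (h : IsDoublingWith w U A) :
    IsDoublingWith w' U A := by
  intro x r hr hU
  have key : ∀ s ≤ 4 * r, ⨍⁻ y in ball x s, ENNReal.ofReal (w y) ∂volume =
      ⨍⁻ y in ball x s, ENNReal.ofReal (w' y) ∂volume := fun s hs =>
    laverage_congr (((ae_restrict_of_ae_restrict_of_subset
      ((ball_subset_ball hs).trans hU) hww)).mono fun y hy => by simp [hy])
  have := h x r hr hU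
  rwa [key _ (by linarith), key _ (by linarith)] at this

lemma weakReverseHolderWith_congr (hww : w =ᵐ[volume.restrict U] w') {q B : ℝ}
    (h : WeakReverseHolderWith w U q B) : WeakReverseHolderWith w' U q B := by
  intro x r hr hU
  have e1 : ⨍⁻ y in ball x (2 * r), ENNReal.ofReal (w y) ∂volume =
      ⨍⁻ y in ball x (2 * r), ENNReal.ofReal (w' y) ∂volume :=
    laverage_congr ((ae_restrict_of_ae_restrict_of_subset hU hww).mono fun y hy => by simp [hy])
  have e2 : ⨍⁻ y in ball x r, ENNReal.ofReal (w y) ^ q ∂volume =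
      ⨍⁻ y in ball x r, ENNReal.ofReal (w' y) ^ q ∂volume :=
    laverage_congr ((ae_restrict_of_ae_restrict_of_subset
      ((ball_subset_ball (by linarith)).trans hU) hww).mono fun y hy => by simp [hy])
  have := h x r hr hU
  rwa [e1, e2] at this

lemma logIsBMOWith_congr (hww : w =ᵐ[volume.restrict U] w') {D : ℝ} (h : LogIsBMOWith w U D) :
    LogIsBMOWith w' U D := by
  refine ⟨by filter_upwards [h.1, hww] with x h1 h2 using h2 ▸ h1, fun x r hr hU => ?_⟩
  obtain ⟨h1, h2⟩ := h.2 x r hr hU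
  have hae : w =ᵐ[volume.restrict (ball x r)] w' :=
    ae_restrict_of_ae_restrict_of_subset ((ball_subset_ball (by linarith)).trans hU) hww
  have hlog : (fun y => Real.log (w y)) =ᵐ[volume.restrict (ball x r)] fun y => Real.log (w' y) :=
    hae.mono fun y hy => by simp [hy]
  refine ⟨h1.congr hlog, ?_⟩
  rw [average_congr hlog] at h2
  refine (laverage_congr (hlog.mono fun y hy => ?_)).trans_le h2
  rw [← hy]

/-- All three conditions see `w` only up to null sets of `U`, so this version may replace it, making
level sets measurable. -/
lemma exists_measurable_nonneg_ae_eq (hU : IsOpen U) (hw : ∀ x ∈ U, 0 ≤ w x)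
    (hloc : LocallyIntegrableOn w U volume) :
    ∃ v : EuclideanSpace ℝ (Fin n) → ℝ, Measurable v ∧ (∀ x, 0 ≤ v x) ∧
      w =ᵐ[volume.restrict U] v ∧
      ∀ (x : EuclideanSpace ℝ (Fin n)) (r : ℝ), closedBall x r ⊆ U →
        ∫⁻ y in ball x r, ENNReal.ofReal (v y) ≠ ∞ := by
  have hm : AEStronglyMeasurable w (volume.restrict U) := hloc.aestronglyMeasurable
  have hae : w =ᵐ[volume.restrict U] fun x => max (hm.mk w x) 0 := by
    filter_upwards [hm.ae_eq_mk, ae_restrict_mem hU.measurableSet] with x h1 h2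
    rw [← h1, max_eq_left (hw x h2)]
  refine ⟨_, hm.stronglyMeasurable_mk.measurable.max measurable_const, fun x => le_max_right _ _,
    hae, fun x r hxr => ?_⟩
  have hi : IntegrableOn w (closedBall x r) := hloc.integrableOn_compact_subset hxr
    (isCompact_closedBall x r)
  have hi' := (hi.mono_set ball_subset_closedBall).congr
    (ae_restrict_of_ae_restrict_of_subset (ball_subset_closedBall.trans hxr) hae)
  have := hi'.hasFiniteIntegral
  rw [hasFiniteIntegral_iff_ofReal (Eventually.of_forall fun y => le_max_right (hm.mk w y) 0)] at this
  exact this.ne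

end

end WeakReverseHolderDoubling

theorem proposition2p3 (n : ℕ) (hn : 1 ≤ n) :
    (∀ (U : Set (EuclideanSpace ℝ (Fin n))) (w : EuclideanSpace ℝ (Fin n) → ℝ),
      IsOpen U → (∀ x ∈ U, 0 ≤ w x) → LocallyIntegrableOn w U volume →
      (∀ x ∈ U, ¬ (∀ᵐ y ∂(volume.restrict (connectedComponentIn U x)), w y = 0)) →
      WeakReverseHolder w U →
      (IsDoubling w U ↔ LogIsBMO w U)) ∧
    (∀ q B D : ℝ, 1 < q → 0 < B → 0 < D →
      ∃ C : ℝ, 0 < C ∧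
        ∀ (U : Set (EuclideanSpace ℝ (Fin n))) (w : EuclideanSpace ℝ (Fin n) → ℝ),
          IsOpen U → (∀ x ∈ U, 0 ≤ w x) → LocallyIntegrableOn w U volume →
          WeakReverseHolderWith w U q B → LogIsBMOWith w U D →
          IsDoublingWith w U C) := by
  have hb : ∀ q B D : ℝ, 1 < q → 0 < B → 0 < D →
      ∃ C : ℝ, 0 < C ∧
        ∀ (U : Set (EuclideanSpace ℝ (Fin n))) (w : EuclideanSpace ℝ (Fin n) → ℝ),
          IsOpen U → (∀ x ∈ U, 0 ≤ w x) → LocallyIntegrableOn w U volume →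
          WeakReverseHolderWith w U q B → LogIsBMOWith w U D →
          IsDoublingWith w U C := by
    intro q B D hq hB hD
    obtain ⟨l, hl, hl'⟩ := WeakReverseHolderDoubling.exists_threshold (κ := √(D * 4 ^ n)) hq hB hD
    refine ⟨2 * 2 ^ n * Real.exp (57 * √(D * 4 ^ n) + l), by positivity, ?_⟩
    intro U w hU hw hloc hWRH hBMO
    obtain ⟨v, hv, -, hwv, hfin⟩ :=
      WeakReverseHolderDoubling.exists_measurable_nonneg_ae_eq hU hw hloc
    exact WeakReverseHolderDoubling.isDoublingWith_congr hwv.symm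
      (WeakReverseHolderDoubling.isDoublingWith_of_logIsBMOWith hv hfin hq hD hl hl'
        (WeakReverseHolderDoubling.weakReverseHolderWith_congr hwv hWRH)
        (WeakReverseHolderDoubling.logIsBMOWith_congr hwv hBMO))
  refine ⟨fun U w hU hw hloc hcomp hWRH => ?_, hb⟩
  obtain ⟨q, B, hq, hB, hWRH⟩ := hWRH
  constructor
  · rintro ⟨A, -, hdb⟩
    obtain ⟨v, hv, hv0, hwv, hfin⟩ :=
      WeakReverseHolderDoubling.exists_measurable_nonneg_ae_eq hU hw hloc
    -- The decay argument needs a doubling constant at least 1.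
    have hdb' : IsDoublingWith v U (max A 1) := fun x r hr hxU =>
      (WeakReverseHolderDoubling.isDoublingWith_congr hwv hdb x r hr hxU).trans
        (mul_le_mul_left (ENNReal.ofReal_le_ofReal (le_max_left _ _)) _)
    have hne : ∀ x ∈ U, ∀ r, 0 < r → ∫⁻ y in Metric.ball x r, ENNReal.ofReal (v y) ≠ 0 := by
      refine fun x hx r hr => WeakReverseHolderDoubling.setLIntegral_ne_zero hU hv hv0 ?_ hdb' hx hr
      intro z hz hzero
      refine hcomp z hz ?_
      filter_upwards [hzero, ae_restrict_of_ae_restrict_of_subset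
        (connectedComponentIn_subset U z) hwv] with y h1 h2
      rw [h2, h1]
    obtain ⟨D, hD, hBMO⟩ := WeakReverseHolderDoubling.logIsBMO_of_isDoublingWith hv hfin hU hne
      hq hB (le_max_right A 1)
      (WeakReverseHolderDoubling.weakReverseHolderWith_congr hwv hWRH) hdb'
    exact ⟨D, hD, WeakReverseHolderDoubling.logIsBMOWith_congr hwv.symm hBMO⟩
  · rintro ⟨D, hD, hBMO⟩
    obtain ⟨C, hC, h⟩ := hb q B D hq hB hD
    exact ⟨C, hC, h U w hU hw hloc hWRH hBMO⟩
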